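/- Let $s=(s_n)_{n\ge 0}$ be a normalized indeterminate Hamburger moment sequence, i.e. there are at least two probability measures $\mu$ on $\mathbb R$ with moments of every order and $\int x^n\,d\mu(x)=s_n$ for all $n\ge 0$. Assume that $s$ is Stieltjes, i.e. at least one of these measures is supported by $[0,\infty)$. Let $P_n$ be the orthonormal polynomials of $s$ (with positive leading coefficients), let $Q_n(x)=\int\frac{P_n(x)-P_n(y)}{x-y}\,d\mu(y)$ be the polynomials of the second kind, and consider the entire functions $$A(z)=z\sum_{k=0}^\infty Q_k(z)Q_k(0),\qquad B(z)=-1+z\sum_{k=0}^\infty P_k(z)Q_k(0),$$ $$C(z)=1+z\sum_{k=0}^\infty Q_k(z)P_k(0),\qquad D(z)=z\sum_{k=0}^\infty P_k(z)P_k(0).$$ Let $\alpha(s)=\lim_{x\to-\infty}\frac{D(x)}{B(x)}=\lim_{n\to\infty}\frac{P_n(0)}{Q_n(0)}$ (both limits exist in $\mathbb R$ and are equal). The zeros of $A$ in $\mathbb C$ are all real and form an infinite strictly increasing sequence $\alpha_1<\alpha_2<\cdots$. The function $l(x)=C(x)/A(x)$ is strictly decreasing in each of the intervals $(-\infty,\alpha_1),(\alpha_1,\alpha_2),(\alpha_2,\alpha_3),\ldots$,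 with one-sided limits $$\lim_{x\to\alpha_k^-}l(x)=-\infty,\qquad \lim_{x\to\alpha_k^+}l(x)=+\infty,\qquad k=1,2,\ldots.$$ Moreover $$\alpha(s)=\lim_{x\to-\infty}\frac{C(x)}{A(x)}.$$ -/

import Mathlib

open MeasureTheory Filter Topology Polynomial

noncomputable section

namespace MomentProblem

/-- `μ` is a solution of the (normalized) Hamburger moment problem for `s`: a probability measure
on `ℝ` with moments of every order, whose `n`-th moment is `s n`. -/
structure IsSolution (s : ℕ → ℝ) (μ : Measure ℝ) : Prop where
  prob : IsProbabilityMeasure μ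
  integrable : ∀ n : ℕ, Integrable (fun x : ℝ => x ^ n) μ
  moment : ∀ n : ℕ, ∫ x : ℝ, x ^ n ∂μ = s n

/-- `s` is a normalized Hamburger moment sequence with more than one solution. -/
def IsIndeterminate (s : ℕ → ℝ) : Prop :=
  ∃ μ ν : Measure ℝ, IsSolution s μ ∧ IsSolution s ν ∧ μ ≠ ν

/-- `s` has a solution supported by `[0, ∞)`. -/
def IsStieltjes (s : ℕ → ℝ) : Prop :=
  ∃ μ : Measure ℝ, IsSolution s μ ∧ μ (Set.Iio 0) = 0

/-- The moment functional `p ↦ ∫ p dμ` (for any solution `μ`), expressed by the moments. -/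
def momentFunctional (s : ℕ → ℝ) (p : ℝ[X]) : ℝ :=
  p.sum fun i c => c * s i

/-- The monic orthogonal polynomials: Gram--Schmidt applied to `1, X, X², …` with respect to
the inner product `(p, q) ↦ momentFunctional s (p * q)`. -/
def monicOrth (s : ℕ → ℝ) (n : ℕ) : ℝ[X] :=
  X ^ n - ∑ k : Fin n,
    C (momentFunctional s (X ^ n * monicOrth s k) /
      momentFunctional s (monicOrth s k * monicOrth s k)) * monicOrth s k
termination_by n
decreasing_by all_goals exact k.isLt

/-- The orthonormal polynomials `P_n` (with positive leading coefficients). -/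
def P (s : ℕ → ℝ) (n : ℕ) : ℝ[X] :=
  C (√(momentFunctional s (monicOrth s n * monicOrth s n)))⁻¹ * monicOrth s n

/-- The polynomials of the second kind
`Q_n(x) = ∫ (P_n(x) - P_n(y)) / (x - y) dμ(y)`, where
`(x ^ m - y ^ m) / (x - y) = ∑_{i < m} x ^ i y ^ (m - 1 - i)`. -/
def Q (s : ℕ → ℝ) (n : ℕ) : ℝ[X] :=
  (P s n).sum fun m c => ∑ i ∈ Finset.range m, C (c * s (m - 1 - i)) * X ^ i

section Nevanlinna

variable {𝕜 : Type} [RCLike 𝕜]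

/- The Nevanlinna functions of two variables, on `ℂ` (`𝕜 = ℂ`) and their restrictions to
the real line (`𝕜 = ℝ`). -/

def A₂ (s : ℕ → ℝ) (u v : 𝕜) : 𝕜 :=
  (u - v) * ∑' k : ℕ, aeval u (Q s k) * aeval v (Q s k)

def B₂ (s : ℕ → ℝ) (u v : 𝕜) : 𝕜 :=
  -1 + (u - v) * ∑' k : ℕ, aeval u (P s k) * aeval v (Q s k)

def C₂ (s : ℕ → ℝ) (u v : 𝕜) : 𝕜 :=
  1 + (u - v) * ∑' k : ℕ, aeval u (Q s k) * aeval v (P s k)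

def D₂ (s : ℕ → ℝ) (u v : 𝕜) : 𝕜 :=
  (u - v) * ∑' k : ℕ, aeval u (P s k) * aeval v (P s k)

/- The Nevanlinna functions of one variable. -/

def nevA (s : ℕ → ℝ) (u : 𝕜) : 𝕜 := A₂ s u 0

def nevB (s : ℕ → ℝ) (u : 𝕜) : 𝕜 := B₂ s u 0

def nevC (s : ℕ → ℝ) (u : 𝕜) : 𝕜 := C₂ s u 0

def nevD (s : ℕ → ℝ) (u : 𝕜) : 𝕜 := D₂ s u 0

end Nevanlinna

/-- The quantity `α(s) = lim_{x → -∞} D(x) / B(x)`. -/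
def alpha (s : ℕ → ℝ) : ℝ :=
  limUnder atBot fun x : ℝ => nevD s x / nevB s x

end MomentProblem

end

/-! Indeterminacy enters through square summability. Two distinct solutions have different Stieltjes
transforms `a ≠ b` at some non-real `z` (`measure_eq_of_stieltjes_transform_eq`). Bessel's
inequality for `1 / (x - z)` puts `a P_k(z) + Q_k(z)` and `b P_k(z) + Q_k(z)` in `ℓ²`, hence both
`P_k(z)` and `Q_k(z)`. A Volterra equation in `n` and a discrete Gronwall estimate carry this to
every point, with bounds giving convergence of all the series and minimal exponential type of `A`.

The zeros and the quotient `C / A` are governed by `A(z)C(w) - C(z)A(w) = (z - w)K(z, w)` with `K(z,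
w) = ∑ Q_k(z) Q_k(w)` (`nevA_mul_nevC_sub`). Taking `w` to be the conjugate of `z` shows that zeros
are real. On the real line `(C / A)' = -K(x, x) / A² < 0`, and at a zero `a` of `A` the quotient has
a simple pole with residue `C(a)² / K(a, a) > 0`, which gives the one-sided limits.

In the Stieltjes case `P_n` has no zero in `(-∞, 0]`, and there `Q_n / P_n` decreases strictly in
`n` from `0`. This fixes all signs. For `x ≤ 0`, `A(x) = x ∑ T_k` and `C(x) = 1 + x ∑ ρ_k T_k`, with
`T_k = |Q_k(x) Q_k(0)|` and `ρ_k = P_k(0) / Q_k(0)`. As `x → -∞` every single weight becomes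
negligible, since the degrees increase, so the weighted mean has the same limit as `ρ_k`. Weights
built from `P_k` treat `D / B` in the same way, whence the common limit `α(s)`.

If `A` had finitely many zeros, all simple, dividing them out would leave a zero-free function of
minimal type, constant by Borel–Carathéodory; so `A` would be polynomially bounded. But on the
negative axis `|A(x)|` dominates a nonzero multiple of `|x Q_k(x)|` for every `k ≥ 1`. The zeros are
isolated and none is negative, so they can be listed in increasing order. -/

namespace MomentProblem

/-! ### The moment functional and the second kind operator -/

/-- The moment functional as a linear map. -/
noncomputable def momentMap (s : ℕ → ℝ) : ℝ[X] →ₗ[ℝ] ℝ :=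
  Polynomial.lsum fun i => LinearMap.mulRight ℝ (s i)

theorem momentFunctional_eq (s : ℕ → ℝ) (p : ℝ[X]) : momentFunctional s p = momentMap s p := by
  simp [momentFunctional, momentMap, Polynomial.lsum_apply]

@[simp] theorem momentMap_C_mul_X_pow (s : ℕ → ℝ) (c : ℝ) (n : ℕ) :
    momentMap s (C c * X ^ n) = c * s n := by
  rw [C_mul_X_pow_eq_monomial]
  simp [momentMap, Polynomial.lsum_apply, Polynomial.sum_monomial_index]

/-- The linear operator `p ↦ ∫ (p(x) - p(y)) / (x - y) dμ(y)`. -/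
noncomputable def secondKind (s : ℕ → ℝ) : ℝ[X] →ₗ[ℝ] ℝ[X] :=
  Polynomial.lsum fun m => ∑ i ∈ Finset.range m,
    (monomial i).comp (LinearMap.mulRight ℝ (s (m - 1 - i)))

theorem Q_eq (s : ℕ → ℝ) (n : ℕ) : Q s n = secondKind s (P s n) := by
  simp only [Q, C_mul_X_pow_eq_monomial]
  simp [secondKind, Polynomial.lsum_apply]

theorem secondKind_C_mul_X_pow (s : ℕ → ℝ) (c : ℝ) (n : ℕ) :
    secondKind s (C c * X ^ n) = ∑ i ∈ Finset.range n, C (c * s (n - 1 - i)) * X ^ i := by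
  simp only [C_mul_X_pow_eq_monomial]
  simp [secondKind, Polynomial.lsum_apply, Polynomial.sum_monomial_index]

theorem secondKind_X_mul (s : ℕ → ℝ) (p : ℝ[X]) :
    secondKind s (X * p) = X * secondKind s p + C (momentMap s p) := by
  induction p using Polynomial.induction_on' with
  | add p q hp hq => rw [mul_add, map_add, hp, hq, map_add, map_add, map_add]; ring
  | monomial n c =>
    rw [← C_mul_X_pow_eq_monomial, show X * (C c * X ^ n) = C c * X ^ (n + 1) by ring,
      secondKind_C_mul_X_pow, secondKind_C_mul_X_pow, momentMap_C_mul_X_pow,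
      Finset.sum_range_succ', Finset.mul_sum]
    congr 1
    · refine Finset.sum_congr rfl fun i _ => ?_
      rw [show n + 1 - 1 - (i + 1) = n - 1 - i by omega]; ring
    · simp

theorem secondKind_X_sub_C_mul (s : ℕ → ℝ) (w : ℝ) (p : ℝ[X]) :
    secondKind s ((X - C w) * p) = (X - C w) * secondKind s p + C (momentMap s p) := by
  rw [sub_mul, map_sub, secondKind_X_mul, ← smul_eq_C_mul, map_smul, smul_eq_C_mul]; ring

@[simp] theorem secondKind_C (s : ℕ → ℝ) (c : ℝ) : secondKind s (C c) = 0 := by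
  simpa using secondKind_C_mul_X_pow s c 0

theorem IsSolution.integrable_eval {s : ℕ → ℝ} {μ : Measure ℝ} (h : IsSolution s μ) (p : ℝ[X]) :
    Integrable (fun x => p.eval x) μ := by
  simp only [eval_eq_sum_range]
  exact integrable_finsetSum _ fun i _ => (h.integrable i).const_mul _

theorem IsSolution.integral_eval {s : ℕ → ℝ} {μ : Measure ℝ} (h : IsSolution s μ) (p : ℝ[X]) :
    ∫ x, p.eval x ∂μ = momentMap s p := by
  induction p using Polynomial.induction_on' with
  | add p q hp hq =>
    simp only [eval_add, map_add]
    rw [integral_add (h.integrable_eval p) (h.integrable_eval q), hp, hq]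
  | monomial n c =>
    rw [← C_mul_X_pow_eq_monomial, momentMap_C_mul_X_pow]
    simp [integral_const_mul, h.moment]

theorem momentMap_mul_self_nonneg {s : ℕ → ℝ} (h : IsIndeterminate s) (p : ℝ[X]) :
    0 ≤ momentMap s (p * p) := by
  obtain ⟨μ, -, hμ, -, -⟩ := h
  rw [← hμ.integral_eval]
  exact integral_nonneg fun x => by simpa using mul_self_nonneg _

theorem ae_eval_eq_zero {s : ℕ → ℝ} {μ : Measure ℝ} (h : IsSolution s μ) {p : ℝ[X]}
    (hp : momentMap s (p * p) = 0) : ∀ᵐ x ∂μ, p.eval x = 0 := by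
  rw [← h.integral_eval, integral_eq_zero_iff_of_nonneg
    (fun x => by simpa using mul_self_nonneg _) (h.integrable_eval _)] at hp
  filter_upwards [hp] with x hx
  simpa using hx

/-- If `∫ p² = 0`, every solution lives on the finite zero set of `p`. The mass of a set is then the
integral of the polynomial interpolating its indicator there, so the moments determine it and two
solutions coincide. -/
theorem momentMap_mul_self_pos {s : ℕ → ℝ} (h : IsIndeterminate s) {p : ℝ[X]} (hp : p ≠ 0) :
    0 < momentMap s (p * p) := by
  refine lt_of_le_of_ne (momentMap_mul_self_nonneg h p) fun h0 => ?_
  obtain ⟨μ, ν, hμ, hν, hne⟩ := h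
  apply hne
  ext E hE
  classical
  let q : ℝ[X] := Lagrange.interpolate p.roots.toFinset id (E.indicator 1)
  have key : ∀ σ : Measure ℝ, IsSolution s σ → σ.real E = momentMap s q := by
    intro σ hσ
    rw [← hσ.integral_eval, ← integral_indicator_one hE]
    apply integral_congr_ae
    filter_upwards [ae_eval_eq_zero hσ h0.symm] with x hx
    have hx' : x ∈ p.roots.toFinset := by simp [hp, hx]
    exact (Lagrange.eval_interpolate_at_node (v := id) (E.indicator (1 : ℝ → ℝ))
      Function.injective_id.injOn hx').symm
  have := hμ.prob
  have := hν.prob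
  rw [← ENNReal.toReal_eq_toReal_iff' (measure_ne_top _ _) (measure_ne_top _ _)]
  exact (key μ hμ).trans (key ν hν).symm

/-! ### Orthonormal polynomials -/

theorem monicOrth_eq (s : ℕ → ℝ) (n : ℕ) : monicOrth s n = X ^ n - ∑ k ∈ Finset.range n,
    C (momentMap s (X ^ n * monicOrth s k) / momentMap s (monicOrth s k * monicOrth s k)) *
      monicOrth s k := by
  rw [monicOrth, ← Fin.sum_univ_eq_sum_range (fun k =>
    C (momentMap s (X ^ n * monicOrth s k) / momentMap s (monicOrth s k * monicOrth s k)) *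
      monicOrth s k)]
  simp only [momentFunctional_eq]

theorem monicOrth_monic_natDegree (s : ℕ → ℝ) (n : ℕ) :
    (monicOrth s n).Monic ∧ (monicOrth s n).natDegree = n := by
  induction n using Nat.strong_induction_on with
  | _ n ih =>
    have hlt : (∑ k ∈ Finset.range n,
        C (momentMap s (X ^ n * monicOrth s k) / momentMap s (monicOrth s k * monicOrth s k)) *
          monicOrth s k).degree < n := by
      refine (Polynomial.degree_sum_le _ _).trans_lt ?_
      refine (Finset.sup_lt_iff (WithBot.bot_lt_coe n)).2 ?_
      intro k hk
      have hk' := Finset.mem_range.1 hk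
      rw [← smul_eq_C_mul]
      refine (degree_smul_le _ _).trans_lt ?_
      rw [degree_eq_natDegree (ih k hk').1.ne_zero, (ih k hk').2]
      exact WithBot.coe_lt_coe.2 hk'
    rw [monicOrth_eq]
    have hm := monic_X_pow_sub hlt
    refine ⟨hm, ?_⟩
    rw [← degree_X_pow (R := ℝ) n] at hlt
    exact natDegree_eq_of_degree_eq_some
      ((degree_sub_eq_left_of_degree_lt hlt).trans (degree_X_pow n))

theorem monicOrth_ne_zero (s : ℕ → ℝ) (n : ℕ) : monicOrth s n ≠ 0 :=
  (monicOrth_monic_natDegree s n).1.ne_zero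

theorem momentMap_monicOrth_of_lt {s : ℕ → ℝ} (h : IsIndeterminate s) {n k : ℕ} (hk : k < n) :
    momentMap s (monicOrth s n * monicOrth s k) = 0 := by
  induction n using Nat.strong_induction_on generalizing k with
  | _ n ih =>
    have hpos := momentMap_mul_self_pos h (monicOrth_ne_zero s k)
    rw [monicOrth_eq s n, sub_mul, map_sub, Finset.sum_mul, map_sum,
      Finset.sum_eq_single k]
    · rw [mul_assoc, ← smul_eq_C_mul, map_smul, smul_eq_mul]
      field_simp
      ring
    · intro j hj hjk
      rw [mul_assoc, ← smul_eq_C_mul, map_smul, smul_eq_mul]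
      rcases lt_or_gt_of_ne hjk with hlt | hlt
      · rw [mul_comm (monicOrth s j) (monicOrth s k), ih k hk hlt, mul_zero]
      · rw [ih j (Finset.mem_range.1 hj) hlt, mul_zero]
    · exact fun hn => absurd (Finset.mem_range.2 hk) hn

/-- The leading coefficient of `P s n`. -/
noncomputable def leadP (s : ℕ → ℝ) (n : ℕ) : ℝ :=
  (√(momentMap s (monicOrth s n * monicOrth s n)))⁻¹

theorem P_eq (s : ℕ → ℝ) (n : ℕ) : P s n = C (leadP s n) * monicOrth s n := by
  simp only [P, leadP, momentFunctional_eq]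

theorem leadP_pos {s : ℕ → ℝ} (h : IsIndeterminate s) (n : ℕ) : 0 < leadP s n :=
  inv_pos.2 (Real.sqrt_pos.2 (momentMap_mul_self_pos h (monicOrth_ne_zero s n)))

theorem natDegree_P {s : ℕ → ℝ} (h : IsIndeterminate s) (n : ℕ) : (P s n).natDegree = n := by
  rw [P_eq, natDegree_C_mul (leadP_pos h n).ne', (monicOrth_monic_natDegree s n).2]

theorem leadingCoeff_P (s : ℕ → ℝ) (n : ℕ) : (P s n).leadingCoeff = leadP s n := by
  rw [P_eq, leadingCoeff_mul, leadingCoeff_C, (monicOrth_monic_natDegree s n).1.leadingCoeff,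
    mul_one]

theorem P_ne_zero {s : ℕ → ℝ} (h : IsIndeterminate s) (n : ℕ) : P s n ≠ 0 := by
  rw [← leadingCoeff_ne_zero, leadingCoeff_P]; exact (leadP_pos h n).ne'

theorem momentMap_P_of_lt {s : ℕ → ℝ} (h : IsIndeterminate s) {n k : ℕ} (hk : k < n) :
    momentMap s (P s n * P s k) = 0 := by
  rw [P_eq, P_eq, show C (leadP s n) * monicOrth s n * (C (leadP s k) * monicOrth s k)
    = C (leadP s n * leadP s k) * (monicOrth s n * monicOrth s k) by rw [C_mul]; ring,
    ← smul_eq_C_mul, map_smul, momentMap_monicOrth_of_lt h hk, smul_zero]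

theorem momentMap_P_self {s : ℕ → ℝ} (h : IsIndeterminate s) (n : ℕ) :
    momentMap s (P s n * P s n) = 1 := by
  have hpos := momentMap_mul_self_pos h (monicOrth_ne_zero s n)
  rw [P_eq, show C (leadP s n) * monicOrth s n * (C (leadP s n) * monicOrth s n)
    = C (leadP s n * leadP s n) * (monicOrth s n * monicOrth s n) by rw [C_mul]; ring,
    ← smul_eq_C_mul, map_smul, smul_eq_mul, leadP, ← mul_inv, Real.mul_self_sqrt hpos.le,
    inv_mul_cancel₀ hpos.ne']

theorem momentMap_P {s : ℕ → ℝ} (h : IsIndeterminate s) (n k : ℕ) :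
    momentMap s (P s n * P s k) = if n = k then 1 else 0 := by
  rcases lt_trichotomy n k with hlt | rfl | hlt
  · rw [mul_comm, momentMap_P_of_lt h hlt, if_neg hlt.ne]
  · rw [momentMap_P_self h, if_pos rfl]
  · rw [momentMap_P_of_lt h hlt, if_neg (ne_of_gt hlt)]

/-- Every polynomial of degree `< n` is a combination of `P 0, …, P (n - 1)`. -/
theorem exists_sum_P {s : ℕ → ℝ} (h : IsIndeterminate s) (n : ℕ) {q : ℝ[X]}
    (hq : q.degree < n) : ∃ c : ℕ → ℝ, q = ∑ k ∈ Finset.range n, C (c k) * P s k := by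
  induction n generalizing q with
  | zero => exact ⟨0, by simpa [Nat.WithBot.lt_zero_iff] using hq⟩
  | succ n ih =>
    have hl := (leadP_pos h n).ne'
    have hdeg : (q - C (q.coeff n / leadP s n) * P s n).degree < n := by
      rw [degree_lt_iff_coeff_zero]
      intro m hm
      rcases hm.eq_or_lt with rfl | hm
      · have : (P s n).coeff n = leadP s n := by
          rw [← leadingCoeff_P s n, leadingCoeff, natDegree_P h]
        rw [coeff_sub, coeff_C_mul, this, div_mul_cancel₀ _ hl, sub_self]
      · rw [coeff_sub, coeff_C_mul, coeff_eq_zero_of_natDegree_lt (p := P s n)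
          (by rwa [natDegree_P h]), mul_zero, sub_zero]
        exact (degree_lt_iff_coeff_zero _ _).1 hq m hm
    obtain ⟨c, hc⟩ := ih hdeg
    refine ⟨fun k => if k = n then q.coeff n / leadP s n else c k, ?_⟩
    dsimp only
    rw [Finset.sum_range_succ, if_pos rfl, Finset.sum_congr rfl (g := fun k => C (c k) * P s k)
      (fun k hk => by rw [if_neg (Finset.mem_range.1 hk).ne]), ← hc]
    ring

theorem momentMap_sum_P {s : ℕ → ℝ} (h : IsIndeterminate s) (n k : ℕ) (c : ℕ → ℝ) :
    momentMap s ((∑ j ∈ Finset.range n, C (c j) * P s j) * P s k) = if k < n then c k else 0 := by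
  rw [Finset.sum_mul, map_sum, Finset.sum_congr rfl (g := fun j => if j = k then c j else 0)
    (fun j _ => by
      rw [mul_assoc, ← smul_eq_C_mul, map_smul, momentMap_P h, smul_eq_mul, mul_ite, mul_one,
        mul_zero])]
  simp

theorem eq_sum_P {s : ℕ → ℝ} (h : IsIndeterminate s) (n : ℕ) {q : ℝ[X]}
    (hq : q.degree < n) : q = ∑ k ∈ Finset.range n, C (momentMap s (q * P s k)) * P s k := by
  obtain ⟨c, hc⟩ := exists_sum_P h n hq
  have : ∀ k ∈ Finset.range n, C (momentMap s (q * P s k)) * P s k = C (c k) * P s k := by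
    intro k hk
    conv_lhs => rw [hc, momentMap_sum_P h, if_pos (Finset.mem_range.1 hk)]
  rw [Finset.sum_congr rfl this]
  exact hc

theorem momentMap_P_mul_of_degree_lt {s : ℕ → ℝ} (h : IsIndeterminate s) (n : ℕ) {q : ℝ[X]}
    (hq : q.degree < n) : momentMap s (P s n * q) = 0 := by
  obtain ⟨c, hc⟩ := exists_sum_P h n hq
  rw [hc, mul_comm, momentMap_sum_P h, if_neg (lt_irrefl n)]

/-! ### The summation formulas -/

/-- The divided difference of `P s n` at `w`. -/
theorem exists_divided_difference {s : ℕ → ℝ} (h : IsIndeterminate s) (n : ℕ) (w : ℝ) :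
    ∃ q : ℝ[X], q.degree < n ∧ P s n = (X - C w) * q + C ((P s n).eval w) ∧
      momentMap s q = (Q s n).eval w := by
  refine ⟨P s n /ₘ (X - C w), ?_, ?_, ?_⟩
  · rcases Nat.eq_zero_or_pos n with rfl | hn
    · have : P s 0 /ₘ (X - C w) = 0 := by
        rw [divByMonic_eq_zero_iff (monic_X_sub_C w), degree_X_sub_C]
        refine degree_le_natDegree.trans_lt ?_
        rw [natDegree_P h]; norm_num
      rw [this, degree_zero]; exact WithBot.bot_lt_coe _
    · refine (degree_divByMonic_lt _ _ (P_ne_zero h n) ?_).trans_le ?_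
      · rw [degree_X_sub_C]; norm_num
      · refine degree_le_natDegree.trans ?_
        rw [natDegree_P h]
  · conv_lhs => rw [← modByMonic_add_div (P s n) (X - C w), modByMonic_X_sub_C_eq_C_eval]
    ring
  · have h1 : P s n = (X - C w) * (P s n /ₘ (X - C w)) + C ((P s n).eval w) := by
      conv_lhs => rw [← modByMonic_add_div (P s n) (X - C w), modByMonic_X_sub_C_eq_C_eval]
      ring
    rw [Q_eq]
    conv_rhs => rw [h1, map_add, secondKind_X_sub_C_mul, secondKind_C]
    simp

/-- The kernel of the summation formulas. -/
noncomputable def volterraKernel {𝕜 : Type*} [CommRing 𝕜] [Algebra ℝ 𝕜] (s : ℕ → ℝ) (n k : ℕ)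
    (w : 𝕜) : 𝕜 :=
  aeval w (P s k) * aeval w (Q s n) - aeval w (P s n) * aeval w (Q s k)

/-- With `r` the divided difference of `P_k` at `w`, `q P_k = P_n r - P_n(w) r + P_k(w) q`.
Orthogonality kills `P_n r`, and the moments of `q` and `r` are `Q_n(w)` and `Q_k(w)`. -/
theorem momentMap_divided_difference {s : ℕ → ℝ} (h : IsIndeterminate s) {n k : ℕ} (hk : k < n)
    {w : ℝ} {q : ℝ[X]} (hq1 : P s n = (X - C w) * q + C ((P s n).eval w))
    (hq2 : momentMap s q = (Q s n).eval w) :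
    momentMap s (q * P s k) = volterraKernel s n k w := by
  obtain ⟨r, hr0, hr1, hr2⟩ := exists_divided_difference h k w
  have h0 : momentMap s (P s n * r) = 0 :=
    momentMap_P_mul_of_degree_lt h n (hr0.trans (by exact_mod_cast hk))
  have e : q * P s k = P s n * r - C ((P s n).eval w) * r + C ((P s k).eval w) * q := by
    conv_lhs => rw [hr1]
    conv_rhs => rw [hq1]
    simp only [eval_add, eval_mul, eval_sub, eval_X, eval_C, sub_self, zero_mul, zero_add]
    ring
  rw [e, map_add, map_sub, h0, ← smul_eq_C_mul, ← smul_eq_C_mul, map_smul, map_smul, hr2, hq2]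
  simp only [volterraKernel, coe_aeval_eq_eval, smul_eq_mul]
  ring

theorem P_eq_sum_real {s : ℕ → ℝ} (h : IsIndeterminate s) (n : ℕ) (w : ℝ) :
    P s n = C ((P s n).eval w) +
      (X - C w) * ∑ k ∈ Finset.range n, C (volterraKernel s n k w) * P s k := by
  obtain ⟨q, hq0, hq1, hq2⟩ := exists_divided_difference h n w
  have := eq_sum_P h n hq0
  rw [Finset.sum_congr rfl (fun k hk => by
    rw [momentMap_divided_difference h (Finset.mem_range.1 hk) hq1 hq2])] at this
  rw [← this, add_comm]; exact hq1

/-- The image of `P_eq_sum_real` under the second kind operator: moving `X - w` past the operator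
produces the constant `∫ q = Q_n(w)`. -/
theorem Q_eq_sum_real {s : ℕ → ℝ} (h : IsIndeterminate s) (n : ℕ) (w : ℝ) :
    Q s n = C ((Q s n).eval w) +
      (X - C w) * ∑ k ∈ Finset.range n, C (volterraKernel s n k w) * Q s k := by
  obtain ⟨q, hq0, hq1, hq2⟩ := exists_divided_difference h n w
  have := eq_sum_P h n hq0
  rw [Finset.sum_congr rfl (fun k hk => by
    rw [momentMap_divided_difference h (Finset.mem_range.1 hk) hq1 hq2])] at this
  have h2 : secondKind s q = ∑ k ∈ Finset.range n, C (volterraKernel s n k w) * Q s k := by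
    rw [this, map_sum]
    exact Finset.sum_congr rfl fun k _ => by rw [← smul_eq_C_mul, map_smul, ← Q_eq, smul_eq_C_mul]
  rw [← h2, ← hq2]
  conv_lhs => rw [Q_eq, hq1, map_add, secondKind_C, secondKind_X_sub_C_mul]
  ring

/-- In the summation formula for `P_{n+1}` only the term `k = n` reaches degree `n + 1`; comparing
leading coefficients gives the value, which is independent of `w`. -/
theorem volterraKernel_succ {s : ℕ → ℝ} (h : IsIndeterminate s) (n : ℕ) (w : ℝ) :
    volterraKernel s (n + 1) n w = leadP s (n + 1) / leadP s n := by
  have e := congrArg (fun p => p.coeff (n + 1)) (P_eq_sum_real h (n + 1) w)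
  have hl : ∀ n, (P s n).coeff n = leadP s n := fun n => by
    rw [← leadingCoeff_P s n, leadingCoeff, natDegree_P h]
  have hz : ∀ k ∈ Finset.range (n + 1), (C (volterraKernel s (n + 1) k w) * P s k).coeff (n + 1)
      = 0 := fun k hk => coeff_eq_zero_of_natDegree_lt (by
        refine (natDegree_C_mul_le _ _).trans_lt ?_
        rw [natDegree_P h]; exact Finset.mem_range.1 hk)
  have hz' : ∀ k ∈ Finset.range n, (C (volterraKernel s (n + 1) k w) * P s k).coeff n
      = 0 := fun k hk => coeff_eq_zero_of_natDegree_lt (by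
        refine (natDegree_C_mul_le _ _).trans_lt ?_
        rw [natDegree_P h]; exact Finset.mem_range.1 hk)
  simp only [coeff_add, sub_mul, coeff_sub, coeff_X_mul, coeff_C_mul, finsetSum_coeff,
    coeff_C_succ, hl] at e
  simp only [coeff_C_mul] at hz hz'
  rw [Finset.sum_eq_zero hz, Finset.sum_range_succ, Finset.sum_eq_zero hz', hl] at e
  rw [eq_div_iff (leadP_pos h n).ne']
  linarith

theorem volterraKernel_succ_pos {s : ℕ → ℝ} (h : IsIndeterminate s) (n : ℕ) (w : ℝ) :
    0 < volterraKernel s (n + 1) n w := by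
  rw [volterraKernel_succ h]; exact div_pos (leadP_pos h _) (leadP_pos h _)

section RCLike

variable {𝕜 : Type*} [RCLike 𝕜]

theorem aeval_ofReal (p : ℝ[X]) (x : ℝ) : aeval (x : 𝕜) p = ((p.eval x : ℝ) : 𝕜) := by
  have := aeval_algebraMap_apply 𝕜 x p
  simpa using this

theorem volterraKernel_ofReal (s : ℕ → ℝ) (n k : ℕ) (w : ℝ) :
    volterraKernel s n k (w : 𝕜) = ((volterraKernel s n k w : ℝ) : 𝕜) := by
  simp [volterraKernel, aeval_ofReal]

/-- For fixed `z` both sides are polynomials in `w` that agree on the real line, an infinite set. -/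
theorem summation_of_real {s : ℕ → ℝ} {R : ℕ → ℝ[X]} {n : ℕ}
    (hR : ∀ w : ℝ, R n = C ((R n).eval w) +
      (X - C w) * ∑ k ∈ Finset.range n, C (volterraKernel s n k w) * R k) (z w : 𝕜) :
    aeval z (R n) = aeval w (R n) +
      (z - w) * ∑ k ∈ Finset.range n, volterraKernel s n k w * aeval z (R k) := by
  let f : ℝ[X] →+* 𝕜[X] := mapRingHom (algebraMap ℝ 𝕜)
  have hf : ∀ (u : 𝕜) (p : ℝ[X]), (f p).eval u = aeval u p := fun u p => by
    simp [f, eval_map_algebraMap]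
  let F : 𝕜[X] := C (aeval z (R n))
  let G : 𝕜[X] := f (R n) + (C z - X) * ∑ k ∈ Finset.range n,
    (f (P s k) * f (Q s n) - f (P s n) * f (Q s k)) * C (aeval z (R k))
  have hG : ∀ u, G.eval u = aeval u (R n) +
      (z - u) * ∑ k ∈ Finset.range n, volterraKernel s n k u * aeval z (R k) := by
    intro u
    simp [G, hf, volterraKernel, eval_finsetSum]
  have hFG : F = G := by
    refine eq_of_infinite_eval_eq F G ?_
    refine (Set.infinite_range_of_injective (RCLike.ofReal_injective (K := 𝕜))).mono ?_
    rintro _ ⟨x, rfl⟩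
    show F.eval _ = G.eval _
    have e := congrArg (aeval z) (hR x)
    rw [hG]
    simp only [F, eval_C]
    rw [e]
    simp [volterraKernel_ofReal, aeval_ofReal, aeval_C]
  have := congrArg (eval w) hFG
  rwa [hG, eval_C] at this

theorem aeval_P_eq_sum {s : ℕ → ℝ} (h : IsIndeterminate s) (n : ℕ) (z w : 𝕜) :
    aeval z (P s n) = aeval w (P s n) +
      (z - w) * ∑ k ∈ Finset.range n, volterraKernel s n k w * aeval z (P s k) :=
  summation_of_real (fun w => P_eq_sum_real h n w) z w

theorem aeval_Q_eq_sum {s : ℕ → ℝ} (h : IsIndeterminate s) (n : ℕ) (z w : 𝕜) :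
    aeval z (Q s n) = aeval w (Q s n) +
      (z - w) * ∑ k ∈ Finset.range n, volterraKernel s n k w * aeval z (Q s k) :=
  summation_of_real (fun w => Q_eq_sum_real h n w) z w

end RCLike

/-! ### A finite measure is determined by its Stieltjes transform -/

theorem ofReal_sub_ne_zero {z : ℂ} (hz : z.im ≠ 0) (x : ℝ) : (x : ℂ) - z ≠ 0 := by
  intro h
  have := congrArg Complex.im h
  simp at this
  exact hz this

theorem norm_inv_ofReal_sub_le {z : ℂ} (hz : z.im ≠ 0) (x : ℝ) :
    ‖((x : ℂ) - z)⁻¹‖ ≤ |z.im|⁻¹ := by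
  rw [norm_inv]
  refine inv_anti₀ (abs_pos.2 hz) ?_
  simpa using Complex.abs_im_le_norm ((x : ℂ) - z)

theorem continuous_inv_ofReal_sub {z : ℂ} (hz : z.im ≠ 0) :
    Continuous fun x : ℝ => ((x : ℂ) - z)⁻¹ :=
  Continuous.inv₀ (by fun_prop) (ofReal_sub_ne_zero hz)

theorem integrable_inv_pow (μ : Measure ℝ) [IsFiniteMeasure μ] {z : ℂ} (hz : z.im ≠ 0) (k : ℕ) :
    Integrable (fun x : ℝ => ((x : ℂ) - z)⁻¹ ^ k) μ := by
  refine Integrable.of_bound ((continuous_inv_ofReal_sub hz).pow k).aestronglyMeasurable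
    (|z.im|⁻¹ ^ k) (Eventually.of_forall fun x => ?_)
  rw [norm_pow]
  exact pow_le_pow_left₀ (norm_nonneg _) (norm_inv_ofReal_sub_le hz x) k

theorem hasDerivAt_integral_inv_pow (μ : Measure ℝ) [IsFiniteMeasure μ] {z : ℂ} (hz : z.im ≠ 0)
    (k : ℕ) : HasDerivAt (fun z : ℂ => ∫ x : ℝ, ((x : ℂ) - z)⁻¹ ^ k ∂μ)
      (∫ x : ℝ, (k : ℂ) * ((x : ℂ) - z)⁻¹ ^ (k + 1) ∂μ) z := by
  -- On this neighbourhood the distance to the real axis exceeds `|Im z| / 2`, so a constant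
  -- dominates the derivative.
  have hs : {u : ℂ | |z.im| / 2 < |u.im|} ∈ 𝓝 z := by
    refine (isOpen_lt (by fun_prop) (by fun_prop)).mem_nhds ?_
    have := abs_pos.2 hz
    show |z.im| / 2 < |z.im|
    linarith
  have hne : ∀ u ∈ {u : ℂ | |z.im| / 2 < |u.im|}, u.im ≠ 0 := fun u hu h0 => by
    have h1 : |z.im| / 2 < |u.im| := hu
    rw [h0, abs_zero] at h1
    linarith [abs_nonneg z.im]
  refine (hasDerivAt_integral_of_dominated_loc_of_deriv_le (𝕜 := ℂ) (μ := μ)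
    (F := fun (u : ℂ) (x : ℝ) => ((x : ℂ) - u)⁻¹ ^ k)
    (F' := fun (u : ℂ) (x : ℝ) => (k : ℂ) * ((x : ℂ) - u)⁻¹ ^ (k + 1))
    (bound := fun _ => k * (|z.im| / 2)⁻¹ ^ (k + 1)) hs ?_
    (integrable_inv_pow μ hz k) ?_ ?_ (integrable_const _) ?_).2
  · filter_upwards [hs] with u hu
    exact (integrable_inv_pow μ (hne u hu) k).aestronglyMeasurable
  · exact ((integrable_inv_pow μ hz (k + 1)).const_mul _).aestronglyMeasurable
  · refine Eventually.of_forall fun x u hu => ?_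
    rw [norm_mul, norm_pow, Complex.norm_natCast]
    have h1 := norm_inv_ofReal_sub_le (hne u hu) x
    have h2 : |u.im|⁻¹ ≤ (|z.im| / 2)⁻¹ := inv_anti₀ (by have := abs_pos.2 hz; positivity) hu.le
    gcongr
    exact h1.trans h2
  · refine Eventually.of_forall fun x u hu => ?_
    have h0 := ofReal_sub_ne_zero (hne u hu) x
    have h1 : HasDerivAt (fun u : ℂ => (x : ℂ) - u) (-1) u := by
      simpa using (hasDerivAt_id u).const_sub (x : ℂ)
    have h2 : HasDerivAt (fun u : ℂ => ((x : ℂ) - u)⁻¹ ^ k)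
      (k * ((x : ℂ) - u)⁻¹ ^ (k - 1) * (- -1 / ((x : ℂ) - u) ^ 2)) u := (h1.inv h0).pow k
    refine h2.congr_deriv ?_
    rcases Nat.eq_zero_or_pos k with rfl | hk
    · simp
    · obtain ⟨m, rfl⟩ := Nat.exists_eq_add_of_lt hk
      rw [Nat.add_sub_cancel, neg_neg, one_div, ← inv_pow]
      ring

/-- Differentiating the identity for the power `k` in `z` gives `k` times the identity for `k + 1`.
-/
theorem integral_inv_pow_eq {μ ν : Measure ℝ} [IsProbabilityMeasure μ] [IsProbabilityMeasure ν]
    (h : ∀ z : ℂ, z.im ≠ 0 → ∫ x : ℝ, ((x : ℂ) - z)⁻¹ ∂μ = ∫ x : ℝ, ((x : ℂ) - z)⁻¹ ∂ν) (k : ℕ)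
    {z : ℂ} (hz : z.im ≠ 0) :
    ∫ x : ℝ, ((x : ℂ) - z)⁻¹ ^ k ∂μ = ∫ x : ℝ, ((x : ℂ) - z)⁻¹ ^ k ∂ν := by
  rcases Nat.eq_zero_or_pos k with rfl | hk
  · simp
  induction k, hk using Nat.le_induction generalizing z with
  | base => simpa using h z hz
  | succ k hk ih =>
    have hU : {u : ℂ | u.im ≠ 0} ∈ 𝓝 z :=
      (isOpen_ne_fun Complex.continuous_im continuous_const).mem_nhds hz
    have h1 := hasDerivAt_integral_inv_pow μ hz k
    have h2 := hasDerivAt_integral_inv_pow ν hz k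
    have h3 := h2.congr_of_eventuallyEq (f₁ := fun z : ℂ => ∫ x : ℝ, ((x : ℂ) - z)⁻¹ ^ k ∂μ)
      (by filter_upwards [hU] with u hu using ih hu)
    have h4 := h1.unique h3
    rw [integral_const_mul, integral_const_mul] at h4
    exact mul_left_cancel₀ (Nat.cast_ne_zero.2 (by omega)) h4

open BoundedContinuousFunction in
/-- The Cayley transform `x ↦ (x - i) / (x + i) = 1 - 2 i / (x + i)` of the real line. -/
noncomputable def cayley : ℝ →ᵇ ℂ :=
  BoundedContinuousFunction.ofNormedAddCommGroup
    (fun x : ℝ => 1 - 2 * Complex.I * ((x : ℂ) - -Complex.I)⁻¹)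
    (continuous_const.sub (continuous_const.mul (continuous_inv_ofReal_sub (by simp)))) 3
    (fun x => by
      refine (norm_sub_le _ _).trans ?_
      have := norm_inv_ofReal_sub_le (z := -Complex.I) (by simp) x
      simp only [norm_mul, norm_one, Complex.norm_I, Complex.norm_ofNat] at this ⊢
      simp only [Complex.neg_im, Complex.I_im, abs_neg, abs_one, inv_one] at this
      linarith)

theorem cayley_apply (x : ℝ) : cayley x = 1 - 2 * Complex.I * ((x : ℂ) - -Complex.I)⁻¹ := rfl

/-- Unitarity collapses mixed products of `cayley` and its star to pure powers, so the star algebra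
it generates is spanned by powers of `cayley` and their conjugates. -/
theorem star_cayley_mul : star cayley * cayley = 1 := by
  ext x
  have h1 : (x : ℂ) + Complex.I ≠ 0 := by
    simpa using ofReal_sub_ne_zero (z := -Complex.I) (by simp) x
  have h2 : (x : ℂ) - Complex.I ≠ 0 := ofReal_sub_ne_zero (z := Complex.I) (by simp) x
  simp only [BoundedContinuousFunction.coe_mul, BoundedContinuousFunction.coe_star, Pi.mul_apply,
    Pi.star_apply, cayley_apply, BoundedContinuousFunction.coe_one, Pi.one_apply]
  simp only [RCLike.star_def, map_sub, map_one, map_mul, map_ofNat, Complex.conj_I, map_inv₀,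
    Complex.conj_ofReal, map_add, sub_neg_eq_add]
  rw [← sub_eq_add_neg]
  field_simp
  ring_nf

/-- By the binomial theorem, `cayley ^ n` is a combination of powers of the resolvent at `-i`. -/
theorem integral_cayley_pow_eq {μ ν : Measure ℝ} [IsProbabilityMeasure μ] [IsProbabilityMeasure ν]
    (h : ∀ z : ℂ, z.im ≠ 0 → ∫ x : ℝ, ((x : ℂ) - z)⁻¹ ∂μ = ∫ x : ℝ, ((x : ℂ) - z)⁻¹ ∂ν)
    (n : ℕ) : ∫ x, cayley x ^ n ∂μ = ∫ x, cayley x ^ n ∂ν := by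
  have hz : (-Complex.I).im ≠ 0 := by simp
  have key : ∀ σ : Measure ℝ, IsProbabilityMeasure σ → ∫ x, cayley x ^ n ∂σ =
      ∑ m ∈ Finset.range (n + 1), ((-(2 * Complex.I)) ^ m * n.choose m) *
        ∫ x : ℝ, ((x : ℂ) - -Complex.I)⁻¹ ^ m ∂σ := by
    intro σ _
    simp_rw [← integral_const_mul]
    rw [← integral_finsetSum _ fun m _ => (integrable_inv_pow σ hz m).const_mul _]
    congr 1 with x
    rw [cayley_apply, show (1 - 2 * Complex.I * ((x : ℂ) - -Complex.I)⁻¹) =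
      -(2 * Complex.I) * ((x : ℂ) - -Complex.I)⁻¹ + 1 by ring, add_pow]
    refine Finset.sum_congr rfl fun m _ => ?_
    rw [mul_pow, one_pow]; ring
  rw [key μ inferInstance, key ν inferInstance]
  exact Finset.sum_congr rfl fun m _ => by rw [integral_inv_pow_eq h m hz]

theorem measure_eq_of_stieltjes_transform_eq {μ ν : Measure ℝ} [IsProbabilityMeasure μ]
    [IsProbabilityMeasure ν]
    (h : ∀ z : ℂ, z.im ≠ 0 → ∫ x : ℝ, ((x : ℂ) - z)⁻¹ ∂μ = ∫ x : ℝ, ((x : ℂ) - z)⁻¹ ∂ν) :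
    μ = ν := by
  refine ext_of_forall_mem_subalgebra_integral_eq_of_pseudoEMetric_complete_countable (𝕜 := ℂ)
    (A := StarAlgebra.adjoin ℂ {cayley}) ?_ ?_
  · intro x y hxy
    refine ⟨cayley, ⟨_, ⟨cayley, StarAlgebra.self_mem_adjoin_singleton ℂ cayley, rfl⟩, rfl⟩, ?_⟩
    intro he
    rw [cayley_apply, cayley_apply] at he
    have h2 : (2 * Complex.I : ℂ) ≠ 0 := by simp
    have h3 := inv_injective (mul_left_cancel₀ h2 (sub_right_injective he))
    exact hxy (Complex.ofReal_injective (sub_left_injective h3))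
  · intro g hg
    have hg' : g ∈ Submodule.span ℂ
        (Submonoid.closure ({cayley} ∪ star {cayley}) : Set (BoundedContinuousFunction ℝ ℂ)) := by
      rw [← StarAlgebra.adjoin_eq_span]; exact hg
    have hcl : ∀ v ∈ Submonoid.closure ({cayley} ∪ star {cayley}),
        ∃ n : ℕ, v = cayley ^ n ∨ v = star cayley ^ n := by
      intro v hv
      have hmul : ∀ m n : ℕ, ∃ k : ℕ, star cayley ^ m * cayley ^ n = cayley ^ k ∨
          star cayley ^ m * cayley ^ n = star cayley ^ k := by
        intro m n
        rcases le_total m n with hmn | hmn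
        · obtain ⟨k, rfl⟩ := Nat.exists_eq_add_of_le hmn
          exact ⟨k, Or.inl (by rw [pow_add, ← mul_assoc, ← mul_pow, star_cayley_mul, one_pow,
            one_mul])⟩
        · obtain ⟨k, rfl⟩ := Nat.exists_eq_add_of_le hmn
          exact ⟨k, Or.inr (by rw [pow_add, mul_right_comm, ← mul_pow, star_cayley_mul, one_pow,
            one_mul])⟩
      induction hv using Submonoid.closure_induction with
      | mem v hv =>
        rcases hv with hv | hv
        · exact ⟨1, Or.inl (by simpa using hv)⟩
        · refine ⟨1, Or.inr ?_⟩
          rw [Set.mem_star, Set.mem_singleton_iff] at hv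
          rw [pow_one, ← hv, star_star]
      | one => exact ⟨0, Or.inl (pow_zero _).symm⟩
      | mul v w _ _ hv hw =>
        obtain ⟨m, rfl | rfl⟩ := hv <;> obtain ⟨n, rfl | rfl⟩ := hw
        · exact ⟨m + n, Or.inl (pow_add _ _ _).symm⟩
        · rw [mul_comm]; exact hmul n m
        · exact hmul m n
        · exact ⟨m + n, Or.inr (pow_add _ _ _).symm⟩
    clear hg
    induction hg' using Submodule.span_induction with
    | mem v hv =>
      obtain ⟨n, rfl | rfl⟩ := hcl v hv
      · simpa using integral_cayley_pow_eq h n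
      · have := congrArg (starRingEnd ℂ) (integral_cayley_pow_eq h n)
        rw [← integral_conj, ← integral_conj] at this
        simpa using this
    | zero => simp
    | add v w _ _ hv hw =>
      simp only [BoundedContinuousFunction.coe_add, Pi.add_apply]
      rw [integral_add (v.integrable μ) (w.integrable μ),
        integral_add (v.integrable ν) (w.integrable ν), hv, hw]
    | smul c v _ hv =>
      simp only [BoundedContinuousFunction.coe_smul, smul_eq_mul]
      rw [integral_const_mul, integral_const_mul, hv]

/-! ### Square summability of the orthonormal polynomials and those of the second kind -/

/-- Induction on the degree through `x / (x - z) = 1 + z / (x - z)`, which matches the recursion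
`secondKind_X_mul`. -/
theorem integral_eval_mul_inv {s : ℕ → ℝ} {μ : Measure ℝ} (hμ : IsSolution s μ) {z : ℂ}
    (hz : z.im ≠ 0) (p : ℝ[X]) :
    Integrable (fun x : ℝ => ((p.eval x : ℝ) : ℂ) * ((x : ℂ) - z)⁻¹) μ ∧
    ∫ x : ℝ, ((p.eval x : ℝ) : ℂ) * ((x : ℂ) - z)⁻¹ ∂μ =
      (∫ x : ℝ, ((x : ℂ) - z)⁻¹ ∂μ) * aeval z p + aeval z (secondKind s p) := by
  have := hμ.prob
  have hint : ∀ p : ℝ[X], Integrable (fun x : ℝ => ((p.eval x : ℝ) : ℂ) * ((x : ℂ) - z)⁻¹) μ :=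
    fun p => (hμ.integrable_eval p).ofReal.mul_bdd (c := |z.im|⁻¹)
      (continuous_inv_ofReal_sub hz).aestronglyMeasurable
      (Eventually.of_forall fun x => norm_inv_ofReal_sub_le hz x)
  refine ⟨hint p, ?_⟩
  induction p using Polynomial.induction_on with
  | C a =>
    simp only [eval_C, secondKind_C, map_zero, add_zero, aeval_C]
    rw [integral_const_mul, mul_comm]; rfl
  | add p q hp hq =>
    simp only [eval_add, Complex.ofReal_add, add_mul, map_add]
    rw [integral_add (hint p) (hint q), hp, hq]; ring
  | monomial n a ih =>
    rw [show C a * X ^ (n + 1) = X * (C a * X ^ n) by ring]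
    set p := C a * X ^ n
    have e : ∀ x : ℝ, (((X * p).eval x : ℝ) : ℂ) * ((x : ℂ) - z)⁻¹ =
        z * (((p.eval x : ℝ) : ℂ) * ((x : ℂ) - z)⁻¹) + ((p.eval x : ℝ) : ℂ) := by
      intro x
      have := ofReal_sub_ne_zero hz x
      simp only [eval_mul, eval_X, Complex.ofReal_mul]
      field_simp
      ring
    simp_rw [e]
    have hp : Integrable (fun x : ℝ => ((p.eval x : ℝ) : ℂ)) μ := (hμ.integrable_eval p).ofReal
    rw [integral_add ((hint p).const_mul z) hp, integral_const_mul, ih,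
      integral_complex_ofReal, hμ.integral_eval, secondKind_X_mul]
    simp only [map_mul, map_add, aeval_X, aeval_C, Complex.coe_algebraMap]
    ring

theorem bessel {s : ℕ → ℝ} (h : IsIndeterminate s) {μ : Measure ℝ} (hμ : IsSolution s μ)
    {f : ℝ → ℝ} (hf : Continuous f) {M : ℝ} (hM : ∀ x, |f x| ≤ M) (n : ℕ) :
    ∑ k ∈ Finset.range n, (∫ x, (P s k).eval x * f x ∂μ) ^ 2 ≤ ∫ x, f x ^ 2 ∂μ := by
  have := hμ.prob
  set c : ℕ → ℝ := fun k => ∫ x, (P s k).eval x * f x ∂μ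
  set g : ℝ[X] := ∑ k ∈ Finset.range n, C (c k) * P s k with hg
  have hint : ∀ p : ℝ[X], Integrable (fun x => p.eval x * f x) μ := fun p =>
    (hμ.integrable_eval p).mul_bdd (c := M) hf.aestronglyMeasurable (Eventually.of_forall hM)
  have hff : Integrable (fun x => f x ^ 2) μ := by
    refine Integrable.of_bound (hf.pow 2).aestronglyMeasurable (M ^ 2)
      (Eventually.of_forall fun x => ?_)
    rw [norm_pow]
    exact pow_le_pow_left₀ (norm_nonneg _) (hM x) 2
  have h1 : ∫ x, g.eval x * f x ∂μ = ∑ k ∈ Finset.range n, c k ^ 2 := by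
    have : ∀ x, g.eval x * f x = ∑ k ∈ Finset.range n, c k * ((P s k).eval x * f x) := by
      intro x
      rw [hg, eval_finsetSum, Finset.sum_mul]
      exact Finset.sum_congr rfl fun k _ => by rw [eval_mul, eval_C]; ring
    simp_rw [this]
    rw [integral_finsetSum _ fun k _ => (hint (P s k)).const_mul _]
    exact Finset.sum_congr rfl fun k _ => by rw [integral_const_mul, sq]
  have h2 : ∫ x, (g * g).eval x ∂μ = ∑ k ∈ Finset.range n, c k ^ 2 := by
    rw [hμ.integral_eval]
    conv_lhs => rw [hg, Finset.mul_sum, map_sum]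
    refine Finset.sum_congr rfl fun k hk => ?_
    rw [show (∑ j ∈ Finset.range n, C (c j) * P s j) * (C (c k) * P s k) =
      C (c k) * ((∑ j ∈ Finset.range n, C (c j) * P s j) * P s k) by ring, ← smul_eq_C_mul,
      map_smul, momentMap_sum_P h, if_pos (Finset.mem_range.1 hk), smul_eq_mul, sq]
  have h3 : 0 ≤ ∫ x, (f x - g.eval x) ^ 2 ∂μ := integral_nonneg fun x => sq_nonneg _
  have h4 : ∀ x, (f x - g.eval x) ^ 2 = f x ^ 2 - 2 * (g.eval x * f x) + (g * g).eval x := by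
    intro x; rw [eval_mul]; ring
  simp_rw [h4] at h3
  have hsub : Integrable (fun x => f x ^ 2 - 2 * (g.eval x * f x)) μ :=
    hff.sub ((hint g).const_mul 2)
  rw [integral_add hsub (hμ.integrable_eval _),
    integral_sub hff ((hint g).const_mul 2), integral_const_mul, h1, h2] at h3
  linarith

/-- These numbers are the Fourier coefficients of `1 / (x - z)` with respect to `P_k`. Since
`bessel` is a real statement, it is applied to the real and imaginary parts. -/
theorem summable_transform {s : ℕ → ℝ} (h : IsIndeterminate s) {μ : Measure ℝ}
    (hμ : IsSolution s μ) {z : ℂ} (hz : z.im ≠ 0) :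
    Summable fun k => ‖(∫ x : ℝ, ((x : ℂ) - z)⁻¹ ∂μ) * aeval z (P s k) + aeval z (Q s k)‖ ^ 2 := by
  have key : ∀ k, (∫ x : ℝ, ((x : ℂ) - z)⁻¹ ∂μ) * aeval z (P s k) + aeval z (Q s k) =
      ⟨∫ x : ℝ, (P s k).eval x * (((x : ℂ) - z)⁻¹).re ∂μ,
        ∫ x : ℝ, (P s k).eval x * (((x : ℂ) - z)⁻¹).im ∂μ⟩ := by
    intro k
    obtain ⟨h1, h2⟩ := integral_eval_mul_inv hμ hz (P s k)
    rw [Q_eq, ← h2]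
    apply Complex.ext
    · rw [← RCLike.re_eq_complex_re, ← integral_re h1]
      simp
    · rw [← RCLike.im_eq_complex_im, ← integral_im h1]
      simp
  have hcont := continuous_inv_ofReal_sub hz
  have hre := bessel h hμ (Complex.continuous_re.comp hcont) (M := |z.im|⁻¹)
    (fun x => (Complex.abs_re_le_norm _).trans (norm_inv_ofReal_sub_le hz x))
  have him := bessel h hμ (Complex.continuous_im.comp hcont) (M := |z.im|⁻¹)
    (fun x => (Complex.abs_im_le_norm _).trans (norm_inv_ofReal_sub_le hz x))
  refine summable_of_sum_range_le (fun k => sq_nonneg _) fun n =>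
    le_trans (le_of_eq ?_) (add_le_add (hre n) (him n))
  rw [← Finset.sum_add_distrib]
  refine Finset.sum_congr rfl fun k _ => ?_
  rw [key, Complex.sq_norm, Complex.normSq_mk]
  simp only [Function.comp_apply]
  ring

/-! ### Square summability passes from one point to all points -/

section RCLike

variable {𝕜 : Type*} [RCLike 𝕜]

/-- The size of the `n`-th terms of the two fundamental solutions at `w`. -/
noncomputable def fundSize (s : ℕ → ℝ) (w : 𝕜) (n : ℕ) : ℝ :=
  ‖aeval w (P s n)‖ + ‖aeval w (Q s n)‖

theorem fundSize_nonneg (s : ℕ → ℝ) (w : 𝕜) (n : ℕ) : 0 ≤ fundSize s w n := by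
  unfold fundSize; positivity

theorem norm_volterraKernel_le (s : ℕ → ℝ) (n k : ℕ) (w : 𝕜) :
    ‖volterraKernel s n k w‖ ≤ fundSize s w n * fundSize s w k := by
  unfold volterraKernel fundSize
  refine (norm_sub_le _ _).trans ?_
  rw [norm_mul, norm_mul]
  nlinarith [mul_nonneg (norm_nonneg (aeval w (P s n))) (norm_nonneg (aeval w (P s k))),
    mul_nonneg (norm_nonneg (aeval w (Q s n))) (norm_nonneg (aeval w (Q s k)))]

/-- A discrete Gronwall inequality. -/
theorem norm_le_of_volterra {d : ℕ → ℝ} (hd : ∀ n, 0 ≤ d n) {R : ℝ} (hR : 0 ≤ R) {x : ℕ → 𝕜}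
    (hx : ∀ n, ‖x n‖ ≤ d n * (1 + R * ∑ k ∈ Finset.range n, d k * ‖x k‖)) (n : ℕ) :
    ‖x n‖ ≤ d n * ∏ k ∈ Finset.range n, (1 + R * d k ^ 2) := by
  have key : ∀ n, 1 + R * ∑ k ∈ Finset.range n, d k * ‖x k‖ ≤
      ∏ k ∈ Finset.range n, (1 + R * d k ^ 2) := by
    intro n
    induction n with
    | zero => simp
    | succ n ih =>
      rw [Finset.sum_range_succ, Finset.prod_range_succ]
      calc 1 + R * (∑ k ∈ Finset.range n, d k * ‖x k‖ + d n * ‖x n‖)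
          ≤ 1 + R * (∑ k ∈ Finset.range n, d k * ‖x k‖ +
            d n * (d n * (1 + R * ∑ k ∈ Finset.range n, d k * ‖x k‖))) := by
            gcongr
            · exact hd n
            · exact hx n
        _ = (1 + R * ∑ k ∈ Finset.range n, d k * ‖x k‖) * (1 + R * d n ^ 2) := by ring
        _ ≤ _ := by gcongr
  exact (hx n).trans (mul_le_mul_of_nonneg_left (key n) (hd n))

/-- The summation formula is a Volterra equation in `n`, and its kernel is bounded by a product of
sizes at `w`; this is the form the Gronwall inequality needs. -/
theorem norm_aeval_le_of_sum {s : ℕ → ℝ} {R : ℕ → ℝ[X]} {z w : 𝕜}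
    (h0 : ∀ n, ‖aeval w (R n)‖ ≤ fundSize s w n)
    (hR : ∀ n, aeval z (R n) = aeval w (R n) +
      (z - w) * ∑ k ∈ Finset.range n, volterraKernel s n k w * aeval z (R k)) (n : ℕ) :
    ‖aeval z (R n)‖ ≤ fundSize s w n *
      ∏ k ∈ Finset.range n, (1 + ‖z - w‖ * fundSize s w k ^ 2) := by
  refine norm_le_of_volterra (x := fun n => aeval z (R n)) (fundSize_nonneg s w) (norm_nonneg _)
    (fun n => ?_) n
  rw [hR n]
  refine (norm_add_le _ _).trans ?_
  rw [mul_add, mul_one, norm_mul]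
  refine add_le_add (h0 n) ?_
  rw [mul_left_comm]
  refine mul_le_mul_of_nonneg_left ?_ (norm_nonneg _)
  rw [Finset.mul_sum]
  refine norm_sum_le_of_le _ fun k _ => ?_
  rw [norm_mul, ← mul_assoc]
  exact mul_le_mul_of_nonneg_right (norm_volterraKernel_le s n k w) (norm_nonneg _)

theorem norm_aeval_P_le {s : ℕ → ℝ} (h : IsIndeterminate s) (z w : 𝕜) (n : ℕ) :
    ‖aeval z (P s n)‖ ≤ fundSize s w n *
      ∏ k ∈ Finset.range n, (1 + ‖z - w‖ * fundSize s w k ^ 2) :=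
  norm_aeval_le_of_sum (fun _ => le_add_of_nonneg_right (norm_nonneg _))
    (fun n => aeval_P_eq_sum h n z w) n

theorem norm_aeval_Q_le {s : ℕ → ℝ} (h : IsIndeterminate s) (z w : 𝕜) (n : ℕ) :
    ‖aeval z (Q s n)‖ ≤ fundSize s w n *
      ∏ k ∈ Finset.range n, (1 + ‖z - w‖ * fundSize s w k ^ 2) :=
  norm_aeval_le_of_sum (fun _ => le_add_of_nonneg_left (norm_nonneg _))
    (fun n => aeval_Q_eq_sum h n z w) n

theorem prod_one_add_le_exp {R : ℝ} (hR : 0 ≤ R) {e : ℕ → ℝ} (he : ∀ k, 0 ≤ e k)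
    (hs : Summable e) (t : Finset ℕ) : ∏ k ∈ t, (1 + R * e k) ≤ Real.exp (R * ∑' k, e k) := by
  calc ∏ k ∈ t, (1 + R * e k) ≤ ∏ k ∈ t, Real.exp (R * e k) := by
        refine Finset.prod_le_prod (fun k _ => ?_) fun k _ => ?_
        · have := mul_nonneg hR (he k); linarith
        · have := Real.add_one_le_exp (R * e k); linarith
    _ = Real.exp (R * ∑ k ∈ t, e k) := by rw [← Real.exp_sum, Finset.mul_sum]
    _ ≤ _ := by
        have := hs.sum_le_tsum t fun k _ => he k
        gcongr

theorem summable_fundSize_of {s : ℕ → ℝ} (h : IsIndeterminate s) {w : 𝕜}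
    (hw : Summable fun n => fundSize s w n ^ 2) (z : 𝕜) :
    Summable fun n => fundSize s z n ^ 2 := by
  refine Summable.of_nonneg_of_le (fun _ => sq_nonneg _) (fun n => ?_)
    (hw.mul_left ((2 * Real.exp (‖z - w‖ * ∑' k, fundSize s w k ^ 2)) ^ 2))
  rw [← mul_pow]
  refine pow_le_pow_left₀ (fundSize_nonneg s z n) ?_ 2
  have h0 := prod_one_add_le_exp (norm_nonneg (z - w)) (fun k => sq_nonneg (fundSize s w k)) hw
    (Finset.range n)
  have h1 := (norm_aeval_P_le h z w n).trans
    (mul_le_mul_of_nonneg_left h0 (fundSize_nonneg s w n))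
  have h2 := (norm_aeval_Q_le h z w n).trans
    (mul_le_mul_of_nonneg_left h0 (fundSize_nonneg s w n))
  have h3 : fundSize s z n = ‖aeval z (P s n)‖ + ‖aeval z (Q s n)‖ := rfl
  linarith

end RCLike

/-- Where the two transforms `a` and `b` differ, the square summable sequences `a p + q` and `b p +
q` can be solved for `p` and `q`. -/
theorem exists_summable_fundSize {s : ℕ → ℝ} (h : IsIndeterminate s) :
    ∃ z : ℂ, Summable fun n => fundSize s z n ^ 2 := by
  obtain ⟨μ, ν, hμ, hν, hne⟩ := id h
  have := hμ.prob
  have := hν.prob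
  have : ∃ z : ℂ, z.im ≠ 0 ∧ ∫ x : ℝ, ((x : ℂ) - z)⁻¹ ∂μ ≠ ∫ x : ℝ, ((x : ℂ) - z)⁻¹ ∂ν := by
    by_contra! hcon
    exact hne (measure_eq_of_stieltjes_transform_eq hcon)
  obtain ⟨z, hz, hw⟩ := this
  have h1 := summable_transform h hμ hz
  have h2 := summable_transform h hν hz
  set a := ∫ x : ℝ, ((x : ℂ) - z)⁻¹ ∂μ
  set b := ∫ x : ℝ, ((x : ℂ) - z)⁻¹ ∂ν
  have hab : 0 < ‖a - b‖ := norm_pos_iff.2 (sub_ne_zero.2 hw)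
  refine ⟨z, Summable.of_nonneg_of_le (fun _ => sq_nonneg _) (fun n => ?_)
    ((h1.add h2).mul_left (2 * ((1 + ‖a‖) / ‖a - b‖ + 1) ^ 2))⟩
  set p := aeval z (P s n)
  set q := aeval z (Q s n)
  set U := a * p + q
  set V := b * p + q
  have e1 : ‖p‖ ≤ (‖U‖ + ‖V‖) / ‖a - b‖ := by
    rw [le_div_iff₀ hab, ← norm_mul, show p * (a - b) = U - V by simp only [U, V]; ring]
    exact norm_sub_le _ _
  have e2 : ‖q‖ ≤ ‖U‖ + ‖a‖ * ‖p‖ := by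
    rw [← norm_mul, show q = U - a * p by simp only [U]; ring]
    exact norm_sub_le _ _
  have e3 : fundSize s z n ≤ ((1 + ‖a‖) / ‖a - b‖ + 1) * (‖U‖ + ‖V‖) := by
    have : fundSize s z n = ‖p‖ + ‖q‖ := rfl
    rw [this]
    calc ‖p‖ + ‖q‖ ≤ (1 + ‖a‖) * ‖p‖ + ‖U‖ := by linarith
      _ ≤ (1 + ‖a‖) * ((‖U‖ + ‖V‖) / ‖a - b‖) + (‖U‖ + ‖V‖) := by
        gcongr
        linarith [norm_nonneg V]
      _ = _ := by ring
  calc fundSize s z n ^ 2 ≤ (((1 + ‖a‖) / ‖a - b‖ + 1) * (‖U‖ + ‖V‖)) ^ 2 :=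
        pow_le_pow_left₀ (fundSize_nonneg s z n) e3 2
    _ ≤ 2 * ((1 + ‖a‖) / ‖a - b‖ + 1) ^ 2 * (‖U‖ ^ 2 + ‖V‖ ^ 2) := by
        rw [mul_pow, mul_comm 2, mul_assoc]
        gcongr
        nlinarith [sq_nonneg (‖U‖ - ‖V‖)]

/-- The size of the values at the origin. -/
noncomputable def size₀ (s : ℕ → ℝ) (n : ℕ) : ℝ := |(P s n).eval 0| + |(Q s n).eval 0|

theorem size₀_nonneg (s : ℕ → ℝ) (n : ℕ) : 0 ≤ size₀ s n := by unfold size₀; positivity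

theorem fundSize_zero {𝕜 : Type*} [RCLike 𝕜] (s : ℕ → ℝ) (n : ℕ) :
    fundSize s (0 : 𝕜) n = size₀ s n := by
  have hz : (0 : 𝕜) = ((0 : ℝ) : 𝕜) := by simp
  rw [fundSize, hz, aeval_ofReal, aeval_ofReal, RCLike.norm_ofReal, RCLike.norm_ofReal, size₀]

theorem summable_size₀ {s : ℕ → ℝ} (h : IsIndeterminate s) :
    Summable fun n => size₀ s n ^ 2 := by
  obtain ⟨z, hz⟩ := exists_summable_fundSize h
  simpa only [fundSize_zero] using summable_fundSize_of h hz 0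

/-! ### Convergence of the Nevanlinna series -/

section Nevanlinna

variable {𝕜 : Type} [RCLike 𝕜] {s : ℕ → ℝ}

/-- The polynomials `R 0, R 1, …` satisfy the growth bounds of the orthonormal polynomials. -/
def HasGrowth (s : ℕ → ℝ) (R : ℕ → ℝ[X]) : Prop :=
  ∀ {𝕜 : Type} [RCLike 𝕜] (z : 𝕜) (n : ℕ), ‖aeval z (R n)‖ ≤
    size₀ s n * ∏ k ∈ Finset.range n, (1 + ‖z‖ * size₀ s k ^ 2)

theorem hasGrowth_P (h : IsIndeterminate s) : HasGrowth s (P s) := by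
  intro 𝕜 _ z n
  simpa only [fundSize_zero, sub_zero] using norm_aeval_P_le h z 0 n

theorem hasGrowth_Q (h : IsIndeterminate s) : HasGrowth s (Q s) := by
  intro 𝕜 _ z n
  simpa only [fundSize_zero, sub_zero] using norm_aeval_Q_le h z 0 n

theorem HasGrowth.norm_le_exp {R : ℕ → ℝ[X]} (hR : HasGrowth s R) (h : IsIndeterminate s)
    {r : ℝ} {z : 𝕜} (hz : ‖z‖ ≤ r) (n : ℕ) :
    ‖aeval z (R n)‖ ≤ size₀ s n * Real.exp (r * ∑' k, size₀ s k ^ 2) := by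
  refine (hR z n).trans (mul_le_mul_of_nonneg_left ?_ (size₀_nonneg s n))
  refine (prod_one_add_le_exp (norm_nonneg z) (fun k => sq_nonneg (size₀ s k))
    (summable_size₀ h) _).trans ?_
  have : 0 ≤ ∑' k, size₀ s k ^ 2 := tsum_nonneg fun k => sq_nonneg _
  gcongr

theorem norm_mul_le_of_hasGrowth {R T : ℕ → ℝ[X]} (hR : HasGrowth s R) (hT : HasGrowth s T)
    (h : IsIndeterminate s) {r : ℝ} {z w : 𝕜} (hz : ‖z‖ ≤ r) (hw : ‖w‖ ≤ r) (n : ℕ) :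
    ‖aeval z (R n) * aeval w (T n)‖ ≤
      size₀ s n ^ 2 * Real.exp (r * ∑' k, size₀ s k ^ 2) ^ 2 := by
  rw [norm_mul, ← mul_pow, sq]
  exact mul_le_mul (hR.norm_le_exp h hz n) (hT.norm_le_exp h hw n) (norm_nonneg _)
    (mul_nonneg (size₀_nonneg s n) (Real.exp_nonneg _))

theorem summable_mul_of_hasGrowth {R T : ℕ → ℝ[X]} (hR : HasGrowth s R) (hT : HasGrowth s T)
    (h : IsIndeterminate s) (z w : 𝕜) : Summable fun n => aeval z (R n) * aeval w (T n) :=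
  Summable.of_norm_bounded ((summable_size₀ h).mul_right _) fun n =>
    norm_mul_le_of_hasGrowth hR hT h (le_max_left ‖z‖ ‖w‖) (le_max_right ‖z‖ ‖w‖) n

theorem continuous_tsum_of_hasGrowth {R T : ℕ → ℝ[X]} (hR : HasGrowth s R) (hT : HasGrowth s T)
    (h : IsIndeterminate s) :
    Continuous fun p : 𝕜 × 𝕜 => ∑' n, aeval p.1 (R n) * aeval p.2 (T n) := by
  rw [continuous_iff_continuousAt]
  intro p
  have hcont : ContinuousOn (fun p : 𝕜 × 𝕜 => ∑' n, aeval p.1 (R n) * aeval p.2 (T n))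
      (Metric.ball 0 (‖p‖ + 1)) := by
    refine continuousOn_tsum (fun n => Continuous.continuousOn ?_)
      ((summable_size₀ h).mul_right (Real.exp ((‖p‖ + 1) * ∑' k, size₀ s k ^ 2) ^ 2))
      fun n x hx => ?_
    · exact ((R n).continuous_aeval.comp continuous_fst).mul
        ((T n).continuous_aeval.comp continuous_snd)
    · rw [mem_ball_zero_iff] at hx
      exact norm_mul_le_of_hasGrowth hR hT h ((norm_fst_le x).trans hx.le)
        ((norm_snd_le x).trans hx.le) n
  exact hcont.continuousAt (Metric.isOpen_ball.mem_nhds (by simp))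

/-! ### The kernel of the second kind polynomials -/

/-- The reproducing kernel `∑ Q_k(z) Q_k(w)`. -/
noncomputable def kerQ (s : ℕ → ℝ) (z w : 𝕜) : 𝕜 := ∑' k, aeval z (Q s k) * aeval w (Q s k)

theorem summable_kerQ (h : IsIndeterminate s) (z w : 𝕜) :
    Summable fun k => aeval z (Q s k) * aeval w (Q s k) :=
  summable_mul_of_hasGrowth (hasGrowth_Q h) (hasGrowth_Q h) h z w

theorem continuous_kerQ (h : IsIndeterminate s) :
    Continuous fun p : 𝕜 × 𝕜 => kerQ s p.1 p.2 :=
  continuous_tsum_of_hasGrowth (hasGrowth_Q h) (hasGrowth_Q h) h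

theorem nevA_eq (s : ℕ → ℝ) (z : 𝕜) : nevA s z = z * kerQ s z 0 := by
  simp [nevA, A₂, kerQ]

theorem continuous_nevA (h : IsIndeterminate s) : Continuous (nevA s : 𝕜 → 𝕜) := by
  rw [show (nevA s : 𝕜 → 𝕜) = fun z => z * kerQ s z 0 from funext (nevA_eq s)]
  exact continuous_id.mul ((continuous_kerQ h).comp (continuous_id.prodMk continuous_const))

theorem continuous_nevC (h : IsIndeterminate s) : Continuous (nevC s : 𝕜 → 𝕜) := by
  have e : (nevC s : 𝕜 → 𝕜) = fun z => 1 + z * ∑' k, aeval z (Q s k) * aeval 0 (P s k) :=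
    funext fun z => by simp only [nevC, C₂, sub_zero]
  rw [e]
  exact continuous_const.add (continuous_id.mul
    ((continuous_tsum_of_hasGrowth (hasGrowth_Q h) (hasGrowth_P h) h).comp
      (continuous_id.prodMk continuous_const)))

/-- Partial sums of `nevA`. -/
noncomputable def partA (s : ℕ → ℝ) (n : ℕ) (z : 𝕜) : 𝕜 :=
  z * ∑ k ∈ Finset.range n, aeval z (Q s k) * aeval 0 (Q s k)

/-- Partial sums of `nevC`. -/
noncomputable def partC (s : ℕ → ℝ) (n : ℕ) (z : 𝕜) : 𝕜 :=
  1 + z * ∑ k ∈ Finset.range n, aeval z (Q s k) * aeval 0 (P s k)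

/-- The summation formula based at `0`, with the factors depending only on `n` pulled out of the
sum. -/
theorem aeval_Q_eq_part (h : IsIndeterminate s) (n : ℕ) (z : 𝕜) :
    aeval z (Q s n) = aeval 0 (Q s n) * partC s n z - aeval 0 (P s n) * partA s n z := by
  have e := aeval_Q_eq_sum h n z 0
  have e2 : ∑ k ∈ Finset.range n, volterraKernel s n k 0 * aeval z (Q s k) =
      aeval 0 (Q s n) * ∑ k ∈ Finset.range n, aeval z (Q s k) * aeval 0 (P s k) -
      aeval 0 (P s n) * ∑ k ∈ Finset.range n, aeval z (Q s k) * aeval (0 : 𝕜) (Q s k) := by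
    rw [Finset.mul_sum, Finset.mul_sum, ← Finset.sum_sub_distrib]
    exact Finset.sum_congr rfl fun k _ => by rw [volterraKernel]; ring
  rw [e, e2, partC, partA]
  ring

/-- Telescoping: by `aeval_Q_eq_part`, passing from `n` to `n + 1` changes the left side by exactly
`(z - w) Q_n(z) Q_n(w)`. -/
theorem part_identity (h : IsIndeterminate s) (n : ℕ) (z w : 𝕜) :
    partA s n z * partC s n w - partC s n z * partA s n w =
      (z - w) * ∑ k ∈ Finset.range n, aeval z (Q s k) * aeval w (Q s k) := by
  induction n with
  | zero => simp [partA, partC]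
  | succ n ih =>
    have hA : ∀ u : 𝕜, partA s (n + 1) u =
        partA s n u + u * (aeval u (Q s n) * aeval 0 (Q s n)) := fun u => by
      rw [partA, partA, Finset.sum_range_succ]; ring
    have hC : ∀ u : 𝕜, partC s (n + 1) u =
        partC s n u + u * (aeval u (Q s n) * aeval 0 (P s n)) := fun u => by
      rw [partC, partC, Finset.sum_range_succ]; ring
    rw [Finset.sum_range_succ, mul_add, ← ih, hA, hA, hC, hC]
    have hz := aeval_Q_eq_part h n z
    have hw := aeval_Q_eq_part h n w
    linear_combination (w * aeval w (Q s n)) * hz - (z * aeval z (Q s n)) * hw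

theorem tendsto_partA (h : IsIndeterminate s) (z : 𝕜) :
    Tendsto (fun n => partA s n z) atTop (𝓝 (nevA s z)) := by
  rw [nevA_eq]
  exact (summable_kerQ h z 0).hasSum.tendsto_sum_nat.const_mul z

theorem tendsto_partC (h : IsIndeterminate s) (z : 𝕜) :
    Tendsto (fun n => partC s n z) atTop (𝓝 (nevC s z)) := by
  simp only [nevC, C₂, sub_zero]
  exact ((summable_mul_of_hasGrowth (hasGrowth_Q h) (hasGrowth_P h) h
    z 0).hasSum.tendsto_sum_nat.const_mul z).const_add 1

theorem nevA_mul_nevC_sub (h : IsIndeterminate s) (z w : 𝕜) :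
    nevA s z * nevC s w - nevC s z * nevA s w = (z - w) * kerQ s z w := by
  refine tendsto_nhds_unique (((tendsto_partA h z).mul (tendsto_partC h w)).sub
    ((tendsto_partC h z).mul (tendsto_partA h w))) ?_
  simp only [part_identity h]
  exact (summable_kerQ h z w).hasSum.tendsto_sum_nat.const_mul (z - w)

theorem P_zero_eq (h : IsIndeterminate s) : P s 0 = C (leadP s 0) := by
  have := natDegree_P h 0
  rw [eq_C_of_natDegree_eq_zero this, ← leadingCoeff_P, leadingCoeff, this]

theorem Q_zero (h : IsIndeterminate s) : Q s 0 = 0 := by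
  rw [Q_eq, P_zero_eq h, secondKind_C]

/-- Supplies one term of `K(x, x)` that never vanishes. As `Q_0 = 0`, the positive kernel value for
the indices `1, 0` is `P_0 Q_1`. -/
theorem Q_one (h : IsIndeterminate s) : ∃ c : ℝ, c ≠ 0 ∧ Q s 1 = C c := by
  refine ⟨(Q s 1).eval 0, fun h0 => ?_, ?_⟩
  · have := volterraKernel_succ_pos h 0 0
    simp [volterraKernel, h0, Q_zero h] at this
  · simpa [Q_zero h] using Q_eq_sum_real h 1 0

theorem kerQ_self_pos (h : IsIndeterminate s) (x : ℝ) : 0 < kerQ s x x := by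
  obtain ⟨c, hc, h1⟩ := Q_one h
  refine (summable_kerQ h x x).tsum_pos (fun k => mul_self_nonneg _) 1 ?_
  simpa [h1] using mul_self_pos.2 hc

/-! ### Reality of the zeros of `A` -/

theorem nevA_ofReal (s : ℕ → ℝ) (x : ℝ) : nevA s (x : ℂ) = ((nevA s x : ℝ) : ℂ) := by
  have hz : ∀ p : ℝ[X], aeval (0 : ℂ) p = ((p.eval 0 : ℝ) : ℂ) := fun p => by
    have := aeval_ofReal (𝕜 := ℂ) p 0
    simpa using this
  have hx : ∀ p : ℝ[X], aeval (x : ℂ) p = ((p.eval x : ℝ) : ℂ) := fun p =>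
    aeval_ofReal (𝕜 := ℂ) p x
  rw [nevA_eq, nevA_eq, kerQ, kerQ]
  simp only [hz, hx, Complex.ofReal_mul, Complex.ofReal_tsum, coe_aeval_eq_eval]

theorem nevA_conj (s : ℕ → ℝ) (z : ℂ) :
    nevA s (starRingEnd ℂ z) = starRingEnd ℂ (nevA s z) := by
  have hz : ∀ p : ℝ[X], aeval (0 : ℂ) p = starRingEnd ℂ (aeval (0 : ℂ) p) := fun p => by
    rw [← Polynomial.aeval_conj, map_zero]
  rw [nevA_eq, nevA_eq, kerQ, kerQ, map_mul, Complex.conj_tsum]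
  congr 1
  refine tsum_congr fun k => ?_
  rw [map_mul, Polynomial.aeval_conj, ← hz]

/-- If `A(z) = 0`, also `A` vanishes at the conjugate, so `(z - z̄) K(z, z̄) = 0`, while `K(z, z̄) =
∑ |Q_k(z)|² > 0`. -/
theorem im_eq_zero_of_nevA_eq_zero (h : IsIndeterminate s) {z : ℂ} (hz : nevA s z = 0) :
    z.im = 0 := by
  have h1 : nevA s (starRingEnd ℂ z) = 0 := by rw [nevA_conj, hz, map_zero]
  have h2 := nevA_mul_nevC_sub h z (starRingEnd ℂ z)
  rw [hz, h1, zero_mul, mul_zero, sub_zero] at h2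
  have h3 : kerQ s z (starRingEnd ℂ z) = ((∑' k, ‖aeval z (Q s k)‖ ^ 2 : ℝ) : ℂ) := by
    rw [kerQ, Complex.ofReal_tsum]
    refine tsum_congr fun k => ?_
    rw [Polynomial.aeval_conj, Complex.mul_conj', Complex.ofReal_pow]
  obtain ⟨c, hc, hQ⟩ := Q_one h
  have hsum : Summable fun k => ‖aeval z (Q s k)‖ ^ 2 := by
    have := (summable_kerQ h z (starRingEnd ℂ z)).norm
    refine this.congr fun k => ?_
    rw [Polynomial.aeval_conj, norm_mul, RCLike.norm_conj, sq]
  have h4 : 0 < ∑' k, ‖aeval z (Q s k)‖ ^ 2 := by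
    refine hsum.tsum_pos (fun k => sq_nonneg _) 1 ?_
    rw [hQ, aeval_C]
    have : (0 : ℝ) < c ^ 2 := by positivity
    simpa using this
  rcases mul_eq_zero.1 h2.symm with h5 | h5
  · rw [sub_eq_zero] at h5
    exact Complex.conj_eq_iff_im.1 h5.symm
  · rw [h3, Complex.ofReal_eq_zero] at h5
    exact absurd h5 h4.ne'

/-! ### The quotient `C / A` -/

/-- The difference quotient equals `-K(y, x) / (A(y) A(x))`, so continuity of `K` and `A` is enough.
-/
theorem hasDerivAt_nevC_div_nevA (h : IsIndeterminate s) {x : ℝ} (hx : nevA s x ≠ 0) :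
    HasDerivAt (fun x : ℝ => nevC s x / nevA s x) (-kerQ s x x / nevA s x ^ 2) x := by
  rw [hasDerivAt_iff_tendsto_slope]
  have hcK : Tendsto (fun y : ℝ => kerQ s y x) (𝓝[≠] x) (𝓝 (kerQ s x x)) :=
    (((continuous_kerQ h).comp (continuous_id.prodMk continuous_const)).tendsto x).mono_left
      nhdsWithin_le_nhds
  have hcA : Tendsto (fun y : ℝ => nevA s y) (𝓝[≠] x) (𝓝 (nevA s x)) :=
    ((continuous_nevA h).tendsto x).mono_left nhdsWithin_le_nhds
  have hlim : Tendsto (fun y : ℝ => -kerQ s y x / (nevA s y * nevA s x)) (𝓝[≠] x)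
      (𝓝 (-kerQ s x x / nevA s x ^ 2)) := by
    rw [sq]
    exact hcK.neg.div (hcA.mul_const _) (mul_ne_zero hx hx)
  refine hlim.congr' ?_
  filter_upwards [hcA.eventually_ne hx, self_mem_nhdsWithin] with y hy hyx
  have hyx' : y - x ≠ 0 := sub_ne_zero.2 hyx
  have := nevA_mul_nevC_sub h y x
  rw [slope_def_field]
  field_simp
  linear_combination this

theorem nevC_ne_zero_of_nevA_eq_zero (h : IsIndeterminate s) {a : ℝ} (ha : nevA s a = 0) :
    nevC s a ≠ 0 := by
  intro hC
  have hpos : ∀ᶠ y in 𝓝[≠] a, 0 < kerQ s y a :=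
    ((((continuous_kerQ h).comp (continuous_id.prodMk continuous_const)).tendsto a).mono_left
      nhdsWithin_le_nhds).eventually_const_lt (kerQ_self_pos h a)
  obtain ⟨y, hy, hya⟩ := (hpos.and self_mem_nhdsWithin).exists
  have := nevA_mul_nevC_sub h y a
  rw [ha, hC, mul_zero, mul_zero, sub_zero] at this
  exact mul_ne_zero (sub_ne_zero.2 hya) hy.ne' this.symm

theorem eventually_nevA_ne_zero (h : IsIndeterminate s) {a : ℝ} (ha : nevA s a = 0) :
    ∀ᶠ y in 𝓝[≠] a, nevA s y ≠ 0 := by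
  have hpos : ∀ᶠ y in 𝓝[≠] a, 0 < kerQ s y a :=
    ((((continuous_kerQ h).comp (continuous_id.prodMk continuous_const)).tendsto a).mono_left
      nhdsWithin_le_nhds).eventually_const_lt (kerQ_self_pos h a)
  filter_upwards [hpos, self_mem_nhdsWithin] with y hy hya h0
  have := nevA_mul_nevC_sub h y a
  rw [ha, h0, zero_mul, mul_zero, sub_zero] at this
  exact mul_ne_zero (sub_ne_zero.2 hya) hy.ne' this.symm

/-- At a zero `a` the identity reads `A(y) C(a) = (y - a) K(y, a)`, which exhibits the simple pole
of `C / A`. -/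
theorem nevC_div_nevA_eventuallyEq (h : IsIndeterminate s) {a : ℝ} (ha : nevA s a = 0) :
    (fun x : ℝ => nevC s x * nevC s a / kerQ s x a * (x - a)⁻¹) =ᶠ[𝓝[≠] a]
      fun x : ℝ => nevC s x / nevA s x := by
  have hC := nevC_ne_zero_of_nevA_eq_zero h ha
  filter_upwards [eventually_nevA_ne_zero h ha, self_mem_nhdsWithin] with y hy hya
  have hya' : y - a ≠ 0 := sub_ne_zero.2 hya
  have := nevA_mul_nevC_sub h y a
  rw [ha, mul_zero, sub_zero] at this
  have hK : kerQ s y a ≠ 0 := fun h0 => mul_ne_zero hy hC (by rw [this, h0, mul_zero])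
  field_simp
  linear_combination (nevC s y) * this

theorem tendsto_residue (h : IsIndeterminate s) (a : ℝ) :
    Tendsto (fun x : ℝ => nevC s x * nevC s a / kerQ s x a) (𝓝 a)
      (𝓝 (nevC s a * nevC s a / kerQ s a a)) :=
  (((continuous_nevC h).tendsto a).mul_const _).div
    (((continuous_kerQ h).comp (continuous_id.prodMk continuous_const)).tendsto a)
    (kerQ_self_pos h a).ne'

theorem residue_pos (h : IsIndeterminate s) {a : ℝ} (ha : nevA s a = 0) :
    0 < nevC s a * nevC s a / kerQ s a a :=
  div_pos (mul_self_pos.2 (nevC_ne_zero_of_nevA_eq_zero h ha)) (kerQ_self_pos h a)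

theorem tendsto_nevC_div_nevA_right (h : IsIndeterminate s) {a : ℝ} (ha : nevA s a = 0) :
    Tendsto (fun x : ℝ => nevC s x / nevA s x) (𝓝[>] a) atTop := by
  have hsub : Tendsto (fun x : ℝ => (x - a)⁻¹) (𝓝[>] a) atTop := by
    refine tendsto_inv_nhdsGT_zero.comp (tendsto_nhdsWithin_iff.2 ⟨?_, ?_⟩)
    · have : Tendsto (fun x : ℝ => x - a) (𝓝 a) (𝓝 (a - a)) :=
        (continuous_id.sub continuous_const).tendsto a
      rw [sub_self] at this
      exact this.mono_left nhdsWithin_le_nhds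
    · filter_upwards [self_mem_nhdsWithin] with x hx using sub_pos.2 (Set.mem_Ioi.1 hx)
  refine Tendsto.congr' ((nevC_div_nevA_eventuallyEq h ha).filter_mono
    (nhdsWithin_mono a fun x hx => ne_of_gt hx)) ?_
  exact ((tendsto_residue h a).mono_left nhdsWithin_le_nhds).pos_mul_atTop (residue_pos h ha) hsub

theorem tendsto_nevC_div_nevA_left (h : IsIndeterminate s) {a : ℝ} (ha : nevA s a = 0) :
    Tendsto (fun x : ℝ => nevC s x / nevA s x) (𝓝[<] a) atBot := by
  have hsub : Tendsto (fun x : ℝ => (x - a)⁻¹) (𝓝[<] a) atBot := by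
    refine tendsto_inv_nhdsLT_zero.comp (tendsto_nhdsWithin_iff.2 ⟨?_, ?_⟩)
    · have : Tendsto (fun x : ℝ => x - a) (𝓝 a) (𝓝 (a - a)) :=
        (continuous_id.sub continuous_const).tendsto a
      rw [sub_self] at this
      exact this.mono_left nhdsWithin_le_nhds
    · filter_upwards [self_mem_nhdsWithin] with x hx using sub_neg.2 (Set.mem_Iio.1 hx)
  refine Tendsto.congr' ((nevC_div_nevA_eventuallyEq h ha).filter_mono
    (nhdsWithin_mono a fun x hx => ne_of_lt hx)) ?_
  exact ((tendsto_residue h a).mono_left nhdsWithin_le_nhds).pos_mul_atBot (residue_pos h ha) hsub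

theorem strictAntiOn_nevC_div_nevA (h : IsIndeterminate s) {S : Set ℝ} (hS : Convex ℝ S)
    (hA : ∀ x ∈ S, nevA s x ≠ 0) : StrictAntiOn (fun x : ℝ => nevC s x / nevA s x) S := by
  refine strictAntiOn_of_deriv_neg hS
    (fun x hx => (hasDerivAt_nevC_div_nevA h (hA x hx)).continuousAt.continuousWithinAt)
    fun x hx => ?_
  have hx' := hA x (interior_subset hx)
  rw [(hasDerivAt_nevC_div_nevA h hx').deriv]
  exact div_neg_of_neg_of_pos (neg_neg_of_pos (kerQ_self_pos h x)) (by positivity)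

end Nevanlinna

/-! ### Signs on the negative half-line in the Stieltjes case -/

section Stieltjes

variable {s : ℕ → ℝ}

/-- If `P_n = (X - x) q`, orthogonality gives `∫ P_n q = 0`. On `[0, ∞)` the integrand `(y - x)
q(y)²` is nonnegative, so it vanishes almost everywhere, and then so does `P_n²`, contradicting its
norm `1`. -/
theorem eval_P_ne_zero (h : IsIndeterminate s) (hS : IsStieltjes s) (n : ℕ) {x : ℝ} (hx : x ≤ 0) :
    (P s n).eval x ≠ 0 := by
  intro h0
  obtain ⟨μ, hμ, hμ0⟩ := hS
  obtain ⟨q, hq0, hq1, -⟩ := exists_divided_difference h n x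
  rw [h0, C_0, add_zero] at hq1
  have h1 := momentMap_P_mul_of_degree_lt h n hq0
  have hnn : ∀ᵐ y ∂μ, 0 ≤ y := by
    rw [ae_iff]
    simp only [not_le]
    exact hμ0
  have hnn' : 0 ≤ᵐ[μ] fun y => (P s n * q).eval y := by
    filter_upwards [hnn] with y hy
    rw [hq1]
    simp only [Pi.zero_apply, eval_mul, eval_sub, eval_X, eval_C]
    have := mul_self_nonneg (q.eval y)
    nlinarith
  rw [← hμ.integral_eval, integral_eq_zero_iff_of_nonneg_ae hnn' (hμ.integrable_eval _)] at h1
  have h2 : ∫ y, (P s n * P s n).eval y ∂μ = 0 := by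
    refine integral_eq_zero_of_ae ?_
    filter_upwards [h1] with y hy
    have e : (P s n * P s n).eval y = (y - x) * (P s n * q).eval y := by
      conv_lhs => rw [hq1]
      conv_rhs => rw [hq1]
      simp only [eval_mul, eval_sub, eval_X, eval_C]
      ring
    rw [e, hy]
    simp
  rw [hμ.integral_eval, momentMap_P_self h] at h2
  exact one_ne_zero h2

theorem neg_one_pow_mul_eval_P_pos (h : IsIndeterminate s) (hS : IsStieltjes s) (n : ℕ) {x : ℝ}
    (hx : x ≤ 0) : 0 < (-1) ^ n * (P s n).eval x := by
  have := zero_lt_negOnePow_mul_eval_of_lt_roots_of_leadingCoeff_nonneg (P := P s n) (x := x)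
    (fun y hy => by
      by_contra! hyx
      exact eval_P_ne_zero h hS n (hyx.trans hx) hy)
    (by rw [leadingCoeff_P]; exact (leadP_pos h n).le)
  rw [natDegree_P h] at this
  simpa [Int.cast_negOnePow_natCast] using this

theorem eval_P_mul_eval_P_pos (h : IsIndeterminate s) (hS : IsStieltjes s) (n : ℕ) {x y : ℝ}
    (hx : x ≤ 0) (hy : y ≤ 0) : 0 < (P s n).eval x * (P s n).eval y := by
  have := mul_pos (neg_one_pow_mul_eval_P_pos h hS n hx) (neg_one_pow_mul_eval_P_pos h hS n hy)
  rwa [mul_mul_mul_comm, ← mul_pow, neg_one_mul, neg_neg, one_pow, one_mul] at this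

/-- The difference of consecutive ratios is the positive kernel value divided by `P_n(x)
P_{n+1}(x)`, and neighbouring `P`s have opposite signs on `(-∞, 0]`. -/
theorem ratio_lt (h : IsIndeterminate s) (hS : IsStieltjes s) (n : ℕ) {x : ℝ} (hx : x ≤ 0) :
    (Q s (n + 1)).eval x / (P s (n + 1)).eval x < (Q s n).eval x / (P s n).eval x := by
  have h1 := eval_P_ne_zero h hS n hx
  have h2 := eval_P_ne_zero h hS (n + 1) hx
  have h3 := volterraKernel_succ_pos h n x
  have h4 : (P s n).eval x * (P s (n + 1)).eval x < 0 := by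
    have := mul_pos (neg_one_pow_mul_eval_P_pos h hS n hx)
      (neg_one_pow_mul_eval_P_pos h hS (n + 1) hx)
    rw [mul_mul_mul_comm, pow_succ, ← mul_assoc ((-1 : ℝ) ^ n), ← mul_pow, neg_one_mul (-1 : ℝ),
      neg_neg, one_pow, one_mul] at this
    linarith
  rw [← sub_neg]
  have e : (Q s (n + 1)).eval x / (P s (n + 1)).eval x - (Q s n).eval x / (P s n).eval x =
      volterraKernel s (n + 1) n x / ((P s n).eval x * (P s (n + 1)).eval x) := by
    simp only [volterraKernel, coe_aeval_eq_eval]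
    field_simp
  rw [e]
  exact div_neg_of_pos_of_neg h3 h4

theorem ratio_strictAnti (h : IsIndeterminate s) (hS : IsStieltjes s) {x : ℝ} (hx : x ≤ 0) :
    StrictAnti fun n => (Q s n).eval x / (P s n).eval x :=
  strictAnti_nat_of_succ_lt fun n => ratio_lt h hS n hx

theorem ratio_neg (h : IsIndeterminate s) (hS : IsStieltjes s) {n : ℕ} (hn : 0 < n) {x : ℝ}
    (hx : x ≤ 0) : (Q s n).eval x / (P s n).eval x < 0 := by
  have := ratio_strictAnti h hS hx hn
  simpa [Q_zero h] using this

theorem eval_Q_ne_zero (h : IsIndeterminate s) (hS : IsStieltjes s) {n : ℕ} (hn : 0 < n) {x : ℝ}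
    (hx : x ≤ 0) : (Q s n).eval x ≠ 0 := fun h0 => by
  have := ratio_neg h hS hn hx
  rw [h0, zero_div] at this
  exact lt_irrefl _ this

theorem eval_P_mul_eval_Q_nonpos (h : IsIndeterminate s) (hS : IsStieltjes s) (n : ℕ) {x y : ℝ}
    (hx : x ≤ 0) (hy : y ≤ 0) : (P s n).eval x * (Q s n).eval y ≤ 0 := by
  rcases Nat.eq_zero_or_pos n with rfl | hn
  · simp [Q_zero h]
  · have h1 := eval_P_ne_zero h hS n hy
    have e : (P s n).eval x * (Q s n).eval y =
        ((P s n).eval x * (P s n).eval y) * ((Q s n).eval y / (P s n).eval y) := by field_simp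
    rw [e]
    exact (mul_neg_of_pos_of_neg (eval_P_mul_eval_P_pos h hS n hx hy) (ratio_neg h hS hn hy)).le

theorem eval_Q_mul_eval_Q_nonneg (h : IsIndeterminate s) (hS : IsStieltjes s) (n : ℕ) {x y : ℝ}
    (hx : x ≤ 0) (hy : y ≤ 0) : 0 ≤ (Q s n).eval x * (Q s n).eval y := by
  have h1 := eval_P_mul_eval_Q_nonpos h hS n hx hx
  have h2 := eval_P_mul_eval_Q_nonpos h hS n hx hy
  have h3 := eval_P_mul_eval_P_pos h hS n hx hx
  -- The product of `h1` and `h2` is `P_n(x)² Q_n(x) Q_n(y)`, and `P_n(x)² > 0`.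
  nlinarith [mul_nonneg_of_nonpos_of_nonpos h1 h2]

/-- The reciprocals of the decreasing negative ratios increase and stay below `0`. The index is
shifted because `Q_0 = 0`. -/
theorem exists_tendsto_ratio (h : IsIndeterminate s) (hS : IsStieltjes s) :
    ∃ a : ℝ, Tendsto (fun n => (P s n).eval 0 / (Q s n).eval 0) atTop (𝓝 a) := by
  have hneg : ∀ n, (Q s (n + 1)).eval 0 / (P s (n + 1)).eval 0 < 0 := fun n =>
    ratio_neg h hS n.succ_pos le_rfl
  have hmono : Monotone fun n => (P s (n + 1)).eval 0 / (Q s (n + 1)).eval 0 := by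
    refine monotone_nat_of_le_succ fun n => ?_
    have := (inv_le_inv_of_neg (hneg n) (hneg (n + 1))).2 (ratio_lt h hS (n + 1) le_rfl).le
    simpa only [inv_div] using this
  have hbdd : BddAbove (Set.range fun n => (P s (n + 1)).eval 0 / (Q s (n + 1)).eval 0) := by
    refine ⟨0, ?_⟩
    rintro _ ⟨n, rfl⟩
    have := inv_neg''.2 (hneg n)
    rw [inv_div] at this
    exact this.le
  exact ⟨_, (tendsto_add_atTop_iff_nat 1).1 (tendsto_atTop_ciSup hmono hbdd)⟩

/-- In the summation formula at `0` the last term has the largest degree and a positive coefficient;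
the factor `X` raises the degree by one. -/
theorem degree_Q_succ (h : IsIndeterminate s) (n : ℕ) : (Q s (n + 1)).degree = n := by
  induction n using Nat.strong_induction_on with
  | _ n ih =>
    rcases n with _ | m
    · obtain ⟨c, hc, h1⟩ := Q_one h
      rw [zero_add, h1, degree_C hc]; rfl
    have hlow : (∑ k ∈ Finset.range (m + 1), C (volterraKernel s (m + 2) k (0 : ℝ)) *
        Q s k).degree < m := by
      refine (degree_sum_le _ _).trans_lt ((Finset.sup_lt_iff (WithBot.bot_lt_coe m)).2 ?_)
      intro k hk
      rw [← smul_eq_C_mul]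
      refine (degree_smul_le _ _).trans_lt ?_
      rcases k with _ | j
      · rw [Q_zero h, degree_zero]; exact WithBot.bot_lt_coe m
      · have hj := Finset.mem_range.1 hk
        rw [ih j (by omega)]
        have hjm : j < m := by omega
        exact WithBot.coe_lt_coe.2 hjm
    have hne := (volterraKernel_succ_pos h (m + 1) 0).ne'
    have htop : (C (volterraKernel s (m + 2) (m + 1) (0 : ℝ)) * Q s (m + 1)).degree = m := by
      rw [degree_C_mul hne, ih m (by omega)]
    have hsum : (∑ k ∈ Finset.range (m + 2), C (volterraKernel s (m + 2) k (0 : ℝ)) *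
        Q s k).degree = m := by
      rw [Finset.sum_range_succ, degree_add_eq_right_of_degree_lt (by rwa [htop]), htop]
    have hX : (X * ∑ k ∈ Finset.range (m + 2), C (volterraKernel s (m + 2) k (0 : ℝ)) *
        Q s k).degree = ((m + 1 : ℕ) : WithBot ℕ) := by
      rw [degree_mul, degree_X, hsum, add_comm]; rfl
    have e := Q_eq_sum_real h (m + 2) 0
    rw [C_0, sub_zero] at e
    rw [e, degree_add_eq_right_of_degree_lt, hX]
    rw [hX]
    refine degree_C_le.trans_lt ?_
    exact_mod_cast m.succ_pos

theorem degree_Q_lt (h : IsIndeterminate s) (n : ℕ) : (Q s n).degree < (Q s (n + 1)).degree := by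
  rw [degree_Q_succ h n]
  rcases n with _ | n
  · rw [Q_zero h, degree_zero]; exact WithBot.bot_lt_coe _
  · rw [degree_Q_succ h n]; exact_mod_cast n.lt_succ_self

theorem degree_P_lt (h : IsIndeterminate s) (n : ℕ) : (P s n).degree < (P s (n + 1)).degree := by
  rw [degree_eq_natDegree (P_ne_zero h n), degree_eq_natDegree (P_ne_zero h (n + 1)),
    natDegree_P h, natDegree_P h]
  exact_mod_cast n.lt_succ_self

/-! ### Behaviour at `-∞` -/

/-- Weighted means of a convergent sequence converge to its limit if each single weight becomes
negligible. -/
theorem tendsto_weighted_mean {ι : Type*} {l : Filter ι} {T : ℕ → ι → ℝ} {ρ : ℕ → ℝ} {a : ℝ}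
    (hρ : Tendsto ρ atTop (𝓝 a)) (hT : ∀ᶠ x in l, (∀ k, 0 ≤ T k x) ∧ (Summable fun k => T k x) ∧
      0 < ∑' k, T k x) (hsmall : ∀ k, Tendsto (fun x => T k x / ∑' j, T j x) l (𝓝 0)) :
    Tendsto (fun x => (∑' k, ρ k * T k x) / ∑' k, T k x) l (𝓝 a) := by
  rw [Metric.tendsto_nhds]
  intro ε hε
  obtain ⟨N, hN⟩ := (Metric.tendsto_atTop.1 hρ) (ε / 2) (half_pos hε)
  have h1 : Tendsto (fun x => ∑ k ∈ Finset.range N, |ρ k - a| * (T k x / ∑' j, T j x)) l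
      (𝓝 0) := by
    have := tendsto_finsetSum (Finset.range N) fun k _ => (hsmall k).const_mul |ρ k - a|
    simpa using this
  filter_upwards [hT, h1.eventually_lt_const (half_pos hε)] with x ⟨hx0, hxs, hxp⟩ hx1
  set S := ∑' k, T k x
  obtain ⟨M, hM⟩ : ∃ M, ∀ k, |ρ k| ≤ M := by
    obtain ⟨M, hM⟩ := (Metric.isBounded_range_of_tendsto ρ hρ).exists_norm_le
    exact ⟨M, fun k => hM _ ⟨k, rfl⟩⟩
  have hs1 : Summable fun k => ρ k * T k x :=
    Summable.of_norm_bounded (hxs.mul_left M) fun k => by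
      rw [norm_mul, Real.norm_of_nonneg (hx0 k)]
      exact mul_le_mul_of_nonneg_right (hM k) (hx0 k)
  have hs2 : Summable fun k => (ρ k - a) * T k x :=
    (hs1.sub (hxs.mul_left a)).congr fun k => by ring
  have e1 : (∑' k, ρ k * T k x) / S - a = (∑' k, (ρ k - a) * T k x) / S := by
    have : ∑' k, (ρ k - a) * T k x = ∑' k, ρ k * T k x - a * S := by
      rw [← tsum_mul_left, ← hs1.tsum_sub (hxs.mul_left a)]
      exact tsum_congr fun k => by ring
    rw [this]
    field_simp
  have hfin : Summable fun k => if k < N then |ρ k - a| * T k x else 0 :=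
    summable_of_hasFiniteSupport ((Set.finite_lt_nat N).subset fun k hk => by
      by_contra hkN
      exact hk (if_neg hkN))
  have e2 : ‖∑' k, (ρ k - a) * T k x‖ ≤
      ∑ k ∈ Finset.range N, |ρ k - a| * T k x + ε / 2 * S := by
    have e3 : ∑' k, (if k < N then |ρ k - a| * T k x else 0) =
        ∑ k ∈ Finset.range N, |ρ k - a| * T k x := by
      rw [tsum_eq_sum (s := Finset.range N) fun k hk => if_neg (by simpa using hk)]
      exact Finset.sum_congr rfl fun k hk => if_pos (Finset.mem_range.1 hk)
    rw [← e3, ← tsum_mul_left, ← hfin.tsum_add (hxs.mul_left _)]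
    refine (norm_tsum_le_tsum_norm hs2.norm).trans ?_
    refine hs2.norm.tsum_le_tsum (fun k => ?_) (hfin.add (hxs.mul_left _))
    rw [norm_mul, Real.norm_of_nonneg (hx0 k), Real.norm_eq_abs]
    have hk0 := hx0 k
    split_ifs with hk
    · have : 0 ≤ ε / 2 * T k x := by positivity
      linarith
    · rw [zero_add]
      have := (hN k (not_lt.1 hk)).le
      rw [Real.dist_eq] at this
      exact mul_le_mul_of_nonneg_right this hk0
  rw [Real.dist_eq, e1, abs_div, abs_of_pos hxp, div_lt_iff₀ hxp]
  have e4 : ∑ k ∈ Finset.range N, |ρ k - a| * T k x =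
      (∑ k ∈ Finset.range N, |ρ k - a| * (T k x / S)) * S := by
    rw [Finset.sum_mul]
    exact Finset.sum_congr rfl fun k _ => by field_simp
  rw [Real.norm_eq_abs, e4] at e2
  nlinarith

/-- The weights whose means are the quotients `D / B` and `C / A`. -/
noncomputable def weight (s : ℕ → ℝ) (R : ℕ → ℝ[X]) (k : ℕ) (x : ℝ) : ℝ :=
  |(R k).eval x * (Q s k).eval 0|

theorem summable_weight (h : IsIndeterminate s) {R : ℕ → ℝ[X]} (hR : HasGrowth s R) (x : ℝ) :
    Summable fun k => weight s R k x := by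
  have := (summable_mul_of_hasGrowth hR (hasGrowth_Q h) h x 0).abs
  simp only [coe_aeval_eq_eval] at this
  exact this

theorem weight_le_tsum (h : IsIndeterminate s) {R : ℕ → ℝ[X]} (hR : HasGrowth s R) (k : ℕ)
    (x : ℝ) : weight s R k x ≤ ∑' j, weight s R j x :=
  (summable_weight h hR x).le_tsum k fun _ _ => abs_nonneg _

theorem weight_pos (h : IsIndeterminate s) (hS : IsStieltjes s) {R : ℕ → ℝ[X]} {k : ℕ}
    {x : ℝ} (hk : 0 < k) (hR : (R k).eval x ≠ 0) : 0 < weight s R k x :=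
  abs_pos.2 (mul_ne_zero hR (eval_Q_ne_zero h hS hk le_rfl))

/-- The sum of the weights is at least the `k`-th one, a nonzero multiple of `|R_k(x)|`, which
outgrows `p`. -/
theorem tendsto_div_tsum_weight (h : IsIndeterminate s) (hS : IsStieltjes s) {R : ℕ → ℝ[X]}
    (hR : HasGrowth s R) {k : ℕ} (hk : 0 < k) (hne : ∀ x ≤ 0, (R k).eval x ≠ 0) {p : ℝ[X]}
    (hp : p.degree < (R k).degree) :
    Tendsto (fun x => |p.eval x| / ∑' j, weight s R j x) atBot (𝓝 0) := by
  have h0 := ((div_tendsto_atBot_zero_of_degree_lt p (R k) hp).abs).mul_const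
    |(Q s k).eval 0|⁻¹
  rw [abs_zero, zero_mul] at h0
  refine squeeze_zero' (Eventually.of_forall fun x => ?_) ?_ h0
  · exact div_nonneg (abs_nonneg _) (tsum_nonneg fun j => abs_nonneg _)
  · filter_upwards [eventually_le_atBot (0 : ℝ)] with x hx
    refine (div_le_div_of_nonneg_left (abs_nonneg _) (weight_pos h hS hk (hne x hx))
      (weight_le_tsum h hR k x)).trans (le_of_eq ?_)
    rw [weight, abs_mul, abs_div]
    ring

theorem tendsto_mean_weight (h : IsIndeterminate s) (hS : IsStieltjes s) {R : ℕ → ℝ[X]}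
    (hR : HasGrowth s R) (hne : ∀ k, 0 < k → ∀ x ≤ 0, (R k).eval x ≠ 0)
    (hdeg : ∀ k, (R k).degree < (R (k + 1)).degree) {a : ℝ}
    (ha : Tendsto (fun n => (P s n).eval 0 / (Q s n).eval 0) atTop (𝓝 a)) :
    Tendsto (fun x => (∑' k, (P s k).eval 0 / (Q s k).eval 0 * weight s R k x) /
      ∑' k, weight s R k x) atBot (𝓝 a) := by
  refine tendsto_weighted_mean ha ?_ fun k => ?_
  · filter_upwards [eventually_le_atBot (0 : ℝ)] with x hx
    exact ⟨fun k => abs_nonneg _, summable_weight h hR x,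
      (weight_pos h hS one_pos (hne 1 one_pos x hx)).trans_le (weight_le_tsum h hR 1 x)⟩
  -- The weight `k` is negligible against the weight `k + 1`, which has larger degree.
  · have := (tendsto_div_tsum_weight h hS hR k.succ_pos (hne _ k.succ_pos) (hdeg k)).mul_const
      |(Q s k).eval 0|
    rw [zero_mul] at this
    refine this.congr fun x => ?_
    rw [weight, abs_mul]
    ring

theorem nevA_real_eq (h : IsIndeterminate s) (hS : IsStieltjes s) {x : ℝ} (hx : x ≤ 0) :
    nevA s x = x * ∑' k, weight s (Q s) k x := by
  rw [nevA_eq, kerQ]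
  congr 1
  refine tsum_congr fun k => ?_
  rw [weight, abs_of_nonneg (eval_Q_mul_eval_Q_nonneg h hS k hx le_rfl)]
  simp only [coe_aeval_eq_eval]

theorem nevC_real_eq (h : IsIndeterminate s) (hS : IsStieltjes s) {x : ℝ} (hx : x ≤ 0) :
    nevC s x = 1 + x * ∑' k, (P s k).eval 0 / (Q s k).eval 0 * weight s (Q s) k x := by
  simp only [nevC, C₂, sub_zero]
  congr 2
  refine tsum_congr fun k => ?_
  rw [weight, abs_of_nonneg (eval_Q_mul_eval_Q_nonneg h hS k hx le_rfl)]
  simp only [coe_aeval_eq_eval]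
  -- For `k = 0` the ratio is `0` by convention on division by `Q_0 = 0`; this is harmless, since
  -- the original term vanishes too.
  rcases Nat.eq_zero_or_pos k with rfl | hk
  · simp [Q_zero h]
  · have := eval_Q_ne_zero h hS hk le_rfl
    field_simp

theorem nevB_real_eq (h : IsIndeterminate s) (hS : IsStieltjes s) {x : ℝ} (hx : x ≤ 0) :
    nevB s x = -1 - x * ∑' k, weight s (P s) k x := by
  simp only [nevB, B₂, sub_zero]
  rw [sub_eq_add_neg, ← mul_neg, ← tsum_neg]
  congr 2
  refine tsum_congr fun k => ?_
  rw [weight, abs_of_nonpos (eval_P_mul_eval_Q_nonpos h hS k hx le_rfl), neg_neg]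
  simp only [coe_aeval_eq_eval]

/-- The term `k = 0` of `D` is `P_0²`, which the weighted sum misses because `Q_0 = 0`; hence the
separate `leadP s 0 ^ 2`. -/
theorem nevD_real_eq (h : IsIndeterminate s) (hS : IsStieltjes s) {x : ℝ} (hx : x ≤ 0) :
    nevD s x = x * (leadP s 0 ^ 2 -
      ∑' k, (P s k).eval 0 / (Q s k).eval 0 * weight s (P s) k x) := by
  simp only [nevD, D₂, sub_zero]
  congr 1
  have hsum := summable_mul_of_hasGrowth (hasGrowth_P h) (hasGrowth_P h) h x 0
  have e : ∀ k, (P s (k + 1)).eval 0 / (Q s (k + 1)).eval 0 * weight s (P s) (k + 1) x =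
      -(aeval x (P s (k + 1)) * aeval 0 (P s (k + 1))) := by
    intro k
    rw [weight, abs_of_nonpos (eval_P_mul_eval_Q_nonpos h hS _ hx le_rfl)]
    have := eval_Q_ne_zero h hS k.succ_pos le_rfl
    simp only [coe_aeval_eq_eval]
    field_simp
  have hsum' : Summable fun k => (P s k).eval 0 / (Q s k).eval 0 * weight s (P s) k x := by
    rw [← summable_nat_add_iff 1]
    simp only [e]
    exact ((summable_nat_add_iff 1).2 hsum).neg
  rw [hsum.tsum_eq_zero_add, hsum'.tsum_eq_zero_add]
  simp only [e, tsum_neg]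
  rw [P_zero_eq h, Q_zero h]
  simp only [coe_aeval_eq_eval, eval_C, eval_zero, div_zero, zero_mul]
  ring

theorem tendsto_inv_tsum_weight_P (h : IsIndeterminate s) (hS : IsStieltjes s) :
    Tendsto (fun x => (∑' j, weight s (P s) j x)⁻¹) atBot (𝓝 0) := by
  have := tendsto_div_tsum_weight h hS (hasGrowth_P h) one_pos
    (fun x hx => eval_P_ne_zero h hS 1 hx) (p := 1) (by
      rw [degree_one, degree_eq_natDegree (P_ne_zero h 1), natDegree_P h]
      exact_mod_cast one_pos)
  simpa using this

theorem tendsto_nevD_div_nevB (h : IsIndeterminate s) (hS : IsStieltjes s) {a : ℝ}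
    (ha : Tendsto (fun n => (P s n).eval 0 / (Q s n).eval 0) atTop (𝓝 a)) :
    Tendsto (fun x : ℝ => nevD s x / nevB s x) atBot (𝓝 a) := by
  have h1 := tendsto_mean_weight h hS (hasGrowth_P h)
    (fun k _ x hx => eval_P_ne_zero h hS k hx) (degree_P_lt h) ha
  have h2 := tendsto_inv_tsum_weight_P h hS
  have h3 : Tendsto (fun x : ℝ => x⁻¹) atBot (𝓝 0) := tendsto_inv_atBot_zero
  -- This is `D / B` with numerator and denominator divided by `-x ∑ T_k`; the corrections from
  -- `P_0²` and from the constant `-1` of `B` tend to `0`.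
  have h4 := (h1.sub (h2.const_mul (leadP s 0 ^ 2))).div ((h3.mul h2).const_add 1) (by norm_num)
  rw [mul_zero, mul_zero, sub_zero, add_zero, div_one] at h4
  refine h4.congr' ?_
  filter_upwards [eventually_lt_atBot (0 : ℝ)] with x hx
  rw [nevD_real_eq h hS hx.le, nevB_real_eq h hS hx.le]
  have hpos : 0 < ∑' j, weight s (P s) j x :=
    (weight_pos h hS one_pos (eval_P_ne_zero h hS 1 hx.le)).trans_le
      (weight_le_tsum h (hasGrowth_P h) 1 x)
  simp only [Pi.div_apply]
  generalize (∑' k, (P s k).eval 0 / (Q s k).eval 0 * weight s (P s) k x) = N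
  generalize (∑' j, weight s (P s) j x) = S at hpos ⊢
  have hx0 : x ≠ 0 := hx.ne
  have e1 : N / S - leadP s 0 ^ 2 * S⁻¹ = (N - leadP s 0 ^ 2) / S := by field_simp
  have e2 : 1 + x⁻¹ * S⁻¹ = (1 + x * S) / (x * S) := by field_simp; ring
  have e3 : x * (leadP s 0 ^ 2 - N) / (-1 - x * S) = x * (N - leadP s 0 ^ 2) / (1 + x * S) := by
    rw [show -1 - x * S = -(1 + x * S) by ring, div_neg, ← neg_div]
    congr 1; ring
  rw [e1, e2, e3, div_div_eq_mul_div]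
  congr 1
  field_simp

theorem tendsto_nevC_div_nevA_atBot (h : IsIndeterminate s) (hS : IsStieltjes s) {a : ℝ}
    (ha : Tendsto (fun n => (P s n).eval 0 / (Q s n).eval 0) atTop (𝓝 a)) :
    Tendsto (fun x : ℝ => nevC s x / nevA s x) atBot (𝓝 a) := by
  have h1 := tendsto_mean_weight h hS (hasGrowth_Q h)
    (fun k hk x hx => eval_Q_ne_zero h hS hk hx) (degree_Q_lt h) ha
  have h2 : Tendsto (fun x => (∑' j, weight s (Q s) j x)⁻¹) atBot (𝓝 0) := by
    -- The index `2` is the first for which `Q_k` is not constant.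
    have := tendsto_div_tsum_weight h hS (hasGrowth_Q h) two_pos
      (fun x hx => eval_Q_ne_zero h hS two_pos hx) (p := 1) (by
        rw [degree_one, show 2 = 1 + 1 from rfl, degree_Q_succ h 1]
        exact_mod_cast one_pos)
    simpa using this
  have h3 : Tendsto (fun x : ℝ => x⁻¹) atBot (𝓝 0) := tendsto_inv_atBot_zero
  have h4 := (h3.mul h2).add h1
  rw [mul_zero, zero_add] at h4
  refine h4.congr' ?_
  filter_upwards [eventually_lt_atBot (0 : ℝ)] with x hx
  rw [nevC_real_eq h hS hx.le, nevA_real_eq h hS hx.le]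
  have hpos : 0 < ∑' j, weight s (Q s) j x :=
    (weight_pos h hS one_pos (eval_Q_ne_zero h hS one_pos hx.le)).trans_le
      (weight_le_tsum h (hasGrowth_Q h) 1 x)
  have hx0 : x ≠ 0 := hx.ne
  field_simp

theorem nevA_neg (h : IsIndeterminate s) (hS : IsStieltjes s) {x : ℝ} (hx : x < 0) :
    nevA s x < 0 := by
  rw [nevA_real_eq h hS hx.le]
  exact mul_neg_of_neg_of_pos hx
    ((weight_pos h hS one_pos (eval_Q_ne_zero h hS one_pos hx.le)).trans_le
      (weight_le_tsum h (hasGrowth_Q h) 1 x))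

end Stieltjes

/-! ### Entire functions of minimal exponential type with finitely many zeros -/

/-- `f` grows slower than every exponential `exp (ε ‖z‖)`. -/
def IsMinimalType (f : ℂ → ℂ) : Prop :=
  ∀ ε > 0, ∃ K : ℝ, ∀ z, ‖f z‖ ≤ K * Real.exp (ε * ‖z‖)

/-- On a disc, a zero-free holomorphic function with value `1` at the centre has a logarithm. -/
theorem exists_log_on_ball {f : ℂ → ℂ} (hf : Differentiable ℂ f) (hf0 : ∀ z, f z ≠ 0)
    (h1 : f 0 = 1) {R : ℝ} (hR : 0 < R) :
    ∃ g : ℂ → ℂ, DifferentiableOn ℂ g (Metric.ball 0 R) ∧ g 0 = 0 ∧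
      ∀ z ∈ Metric.ball (0 : ℂ) R, f z = Complex.exp (g z) := by
  have hd : DifferentiableOn ℂ (fun z => deriv f z / f z) (Metric.ball 0 R) := by
    have h2 : Differentiable ℂ (deriv f) := (hf.contDiff (n := 2)).differentiable_deriv_two
    exact (h2.div hf hf0).differentiableOn
  obtain ⟨g, hg0, hg⟩ := hd.isExactOn_ball.with_val_at 0 0
  refine ⟨g, fun z hz => (hg z hz).differentiableAt.differentiableWithinAt, hg0, ?_⟩
  have hF : ∀ z ∈ Metric.ball (0 : ℂ) R,
      HasDerivAt (fun z => f z * Complex.exp (-g z)) 0 z := by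
    intro z hz
    have := (hf z).hasDerivAt.mul ((hg z hz).neg.cexp)
    refine this.congr_deriv ?_
    have := hf0 z
    field_simp
    ring
  intro z hz
  have hconst := (convex_ball (0 : ℂ) R).is_const_of_fderivWithin_eq_zero (𝕜 := ℂ)
    (f := fun z => f z * Complex.exp (-g z))
    (fun z hz => (hF z hz).differentiableAt.differentiableWithinAt) (fun z hz => by
      rw [fderivWithin_of_isOpen Metric.isOpen_ball hz]
      have := (hF z hz).hasFDerivAt.fderiv
      rw [this]
      ext; simp) hz (Metric.mem_ball_self hR)
  simp only [h1, hg0, neg_zero, Complex.exp_zero, mul_one] at hconst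
  rw [Complex.exp_neg] at hconst
  have := Complex.exp_ne_zero (g z)
  field_simp at hconst
  exact hconst

/-- On a large disc `f = exp g` with `Re g ≤ log K + ε R ≤ 2 ε R`. Borel–Carathéodory bounds
`|g(z)|` by `4 ε R |z| / (R - |z|) ≤ 8 ε |z|`, and `ε` is arbitrary. -/
theorem eq_one_of_isMinimalType {f : ℂ → ℂ} (hf : Differentiable ℂ f) (hf0 : ∀ z, f z ≠ 0)
    (h1 : f 0 = 1) (ht : IsMinimalType f) (z : ℂ) : f z = 1 := by
  have key : ∀ δ : ℝ, 0 < δ → δ ≤ 1 → ‖f z - 1‖ ≤ 2 * δ := by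
    intro δ hδ hδ1
    set ε : ℝ := δ / (8 * (‖z‖ + 1)) with hε
    have hz := norm_nonneg z
    have hεpos : 0 < ε := by positivity
    obtain ⟨K, hK⟩ := ht ε hεpos
    have hK1 : 1 ≤ K := by simpa [h1] using hK 0
    -- The first entry ensures `R - |z| ≥ R / 2`, the second absorbs `log K` into `ε R`.
    set R : ℝ := max (2 * ‖z‖ + 1) (Real.log K / ε) with hR
    have hR1 : 2 * ‖z‖ + 1 ≤ R := le_max_left _ _
    have hR2 : Real.log K ≤ ε * R := by
      have : Real.log K / ε ≤ R := le_max_right _ _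
      rw [div_le_iff₀ hεpos] at this
      linarith
    have hRpos : 0 < R := by linarith
    obtain ⟨g, hgd, hg0, hg⟩ := exists_log_on_ball hf hf0 h1 hRpos
    have hmaps : Set.MapsTo g (Metric.ball 0 R) {u | u.re ≤ 2 * (ε * R)} := by
      intro u hu
      have hu' := mem_ball_zero_iff.1 hu
      have h3 := hK u
      rw [hg u hu, Complex.norm_exp] at h3
      have hKe : K = Real.exp (Real.log K) := (Real.exp_log (by linarith)).symm
      rw [hKe, ← Real.exp_add, Real.exp_le_exp] at h3
      have : ε * ‖u‖ ≤ ε * R := by gcongr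
      show (g u).re ≤ 2 * (ε * R)
      linarith
    have hzR : z ∈ Metric.ball (0 : ℂ) R := by rw [mem_ball_zero_iff]; linarith
    have hb := Complex.borelCaratheodory_zero (by positivity) hgd hmaps hRpos hzR hg0
    have hgz : ‖g z‖ ≤ δ := by
      refine hb.trans ?_
      rw [div_le_iff₀ (by linarith)]
      have e : δ = ε * (8 * (‖z‖ + 1)) := by rw [hε]; field_simp
      have h5 : 0 ≤ ε * ‖z‖ := by positivity
      rw [e]
      nlinarith [mul_nonneg h5 (by linarith : 0 ≤ R - 2 * ‖z‖), mul_pos hεpos hRpos,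
        mul_nonneg hεpos.le (by linarith : 0 ≤ R - ‖z‖)]
    rw [hg z hzR]
    exact (Complex.norm_exp_sub_one_le (hgz.trans hδ1)).trans (by linarith)
  have h0 : ‖f z - 1‖ ≤ 0 := by
    refine le_of_forall_pos_le_add fun δ hδ => ?_
    have := key (min (δ / 2) 1) (lt_min (half_pos hδ) one_pos) (min_le_right _ _)
    have h2 := min_le_left (δ / 2) (1 : ℝ)
    linarith
  exact sub_eq_zero.1 (norm_le_zero_iff.1 h0)

/-- Outside the unit disc about `a`, division by `z - a` does not increase the norm; inside it
compactness gives a bound. -/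
theorem IsMinimalType.dslope {f : ℂ → ℂ} (ht : IsMinimalType f) {a : ℂ}
    (ha : f a = 0) (hd : Differentiable ℂ (dslope f a)) : IsMinimalType (dslope f a) := by
  intro ε hε
  obtain ⟨K, hK⟩ := ht ε hε
  obtain ⟨M, hM⟩ :=
    (isCompact_closedBall a 1).exists_bound_of_continuousOn hd.continuous.continuousOn
  refine ⟨max K M, fun z => ?_⟩
  have h1 : 1 ≤ Real.exp (ε * ‖z‖) := Real.one_le_exp (by positivity)
  by_cases hz : z ∈ Metric.closedBall a 1
  · have h2 := hM z hz
    have hM0 : 0 ≤ M := (norm_nonneg _).trans h2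
    calc ‖_root_.dslope f a z‖ ≤ M * 1 := by linarith
      _ ≤ max K M * Real.exp (ε * ‖z‖) :=
        mul_le_mul (le_max_right _ _) h1 zero_le_one (hM0.trans (le_max_right _ _))
  · rw [Metric.mem_closedBall, not_le, dist_eq_norm] at hz
    have e : (z - a) * _root_.dslope f a z = f z := by
      have := sub_smul_dslope f a z
      rw [ha, sub_zero, smul_eq_mul] at this
      exact this
    have h2 : ‖_root_.dslope f a z‖ ≤ ‖f z‖ := by
      rw [← e, norm_mul]
      exact le_mul_of_one_le_left (norm_nonneg _) hz.le
    exact h2.trans ((hK z).trans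
      (mul_le_mul_of_nonneg_right (le_max_left _ _) (Real.exp_nonneg _)))

/-- An entire function of minimal exponential type with finitely many zeros, all simple, is
polynomially bounded. -/
theorem exists_polynomial_bound (F : Finset ℂ) {f : ℂ → ℂ} (hf : Differentiable ℂ f)
    (ht : IsMinimalType f) (hF : ∀ z, f z = 0 → z ∈ F) (hs : ∀ z, f z = 0 → deriv f z ≠ 0) :
    ∃ (K : ℝ) (N : ℕ), 0 ≤ K ∧ ∀ z, ‖f z‖ ≤ K * (1 + ‖z‖) ^ N := by
  induction F using Finset.induction_on generalizing f with
  | empty =>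
    have hf0 : ∀ z, f z ≠ 0 := fun z hz => by simpa using hF z hz
    refine ⟨‖f 0‖, 0, norm_nonneg _, fun z => ?_⟩
    have h0 := hf0 0
    have hmt : IsMinimalType fun z => f z / f 0 := by
      intro ε hε
      obtain ⟨K, hK⟩ := ht ε hε
      refine ⟨K / ‖f 0‖, fun z => ?_⟩
      rw [norm_div, div_mul_eq_mul_div]
      gcongr
      exact hK z
    have := eq_one_of_isMinimalType (hf.div_const (f 0))
      (fun z => div_ne_zero (hf0 z) h0) (div_self h0) hmt z
    rw [div_eq_one_iff_eq h0] at this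
    rw [this, pow_zero, mul_one]
  | insert a F haF ih =>
    by_cases ha : f a = 0
    swap
    · refine ih hf ht (fun z hz => ?_) hs
      rcases Finset.mem_insert.1 (hF z hz) with rfl | h
      · exact absurd hz ha
      · exact h
    have hd : Differentiable ℂ (dslope f a) := by
      rw [← differentiableOn_univ] at hf ⊢
      exact (Complex.differentiableOn_dslope Filter.univ_mem).2 hf
    have e : ∀ z, f z = (z - a) * dslope f a z := fun z => by
      have := sub_smul_dslope f a z
      rw [ha, sub_zero, smul_eq_mul] at this
      exact this.symm
    have hga : dslope f a a ≠ 0 := by rw [dslope_same]; exact hs a ha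
    obtain ⟨K, N, hK0, hK⟩ := ih hd (ht.dslope ha hd) (fun z hz => by
      have hfz : f z = 0 := by rw [e z, hz, mul_zero]
      rcases Finset.mem_insert.1 (hF z hfz) with rfl | h
      · exact absurd hz hga
      · exact h) (fun z hz hz' => by
      have hfz : f z = 0 := by rw [e z, hz, mul_zero]
      refine hs z hfz ?_
      have h1 : HasDerivAt (fun z => (z - a) * dslope f a z)
          (1 * dslope f a z + (z - a) * deriv (dslope f a) z) z :=
        ((hasDerivAt_id z).sub_const a).mul (hd z).hasDerivAt
      rw [show f = fun z => (z - a) * dslope f a z from funext e, h1.deriv, hz, hz']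
      ring)
    refine ⟨(1 + ‖a‖) * K, N + 1, by positivity, fun z => ?_⟩
    rw [e z, norm_mul]
    calc ‖z - a‖ * ‖dslope f a z‖ ≤ (‖z‖ + ‖a‖) * (K * (1 + ‖z‖) ^ N) := by
          gcongr
          · exact norm_sub_le _ _
          · exact hK z
      _ ≤ ((1 + ‖a‖) * (1 + ‖z‖)) * (K * (1 + ‖z‖) ^ N) := by
          gcongr
          nlinarith [norm_nonneg z, norm_nonneg a, mul_nonneg (norm_nonneg z) (norm_nonneg a)]
      _ = _ := by ring

/-! ### The function `A` has infinitely many zeros -/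

/-- The tail of the product costs `exp (η R / 2)` because its sum is below `η / 2`. Each of the `N`
head factors is at most a constant times `exp (δ R)`, and `N δ ≤ η / 2`. -/
theorem exists_prod_le_exp {c : ℕ → ℝ} (hc : ∀ k, 0 ≤ c k) (hs : Summable c) {η : ℝ} (hη : 0 < η) :
    ∃ K : ℝ, 0 ≤ K ∧ ∀ R : ℝ, 0 ≤ R → ∀ n,
      ∏ k ∈ Finset.range n, (1 + R * c k) ≤ K * Real.exp (η * R) := by
  obtain ⟨N, hN⟩ : ∃ N, ∑' k, c (k + N) < η / 2 :=
    ((tendsto_sum_nat_add c).eventually_lt_const (half_pos hη)).exists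
  set δ : ℝ := η / 2 / (N + 1) with hδ
  have hδ0 : 0 < δ := by positivity
  refine ⟨∏ k ∈ Finset.range N, (1 + c k / δ), Finset.prod_nonneg fun k _ => ?_,
    fun R hR n => ?_⟩
  · have := hc k; positivity
  have hone : ∀ (k : ℕ), 1 ≤ 1 + R * c k := fun k => by
    have := mul_nonneg hR (hc k); linarith
  have h1 : ∏ k ∈ Finset.range n, (1 + R * c k) ≤ ∏ k ∈ Finset.range (n + N), (1 + R * c k) := by
    rw [Finset.prod_range_add]
    refine le_mul_of_one_le_right (Finset.prod_nonneg fun k _ => zero_le_one.trans (hone k)) ?_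
    exact Finset.prod_induction _ (fun x : ℝ => 1 ≤ x) (fun _ _ => one_le_mul_of_one_le_of_one_le)
      le_rfl fun k _ => hone _
  have h2 : ∏ k ∈ Finset.range N, (1 + R * c k) ≤
      (∏ k ∈ Finset.range N, (1 + c k / δ)) * Real.exp (η / 2 * R) := by
    calc ∏ k ∈ Finset.range N, (1 + R * c k)
        ≤ ∏ k ∈ Finset.range N, ((1 + c k / δ) * Real.exp (δ * R)) := by
          refine Finset.prod_le_prod (fun k _ => zero_le_one.trans (hone k)) fun k _ => ?_
          have hck := hc k
          calc 1 + R * c k ≤ (1 + c k / δ) * (1 + δ * R) := by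
                have e : (1 + c k / δ) * (1 + δ * R) = 1 + R * c k + (c k / δ + δ * R) := by
                  field_simp; ring
                rw [e]
                have : 0 ≤ c k / δ + δ * R := by positivity
                linarith
            _ ≤ _ := by
                gcongr
                linarith [Real.add_one_le_exp (δ * R)]
      _ = (∏ k ∈ Finset.range N, (1 + c k / δ)) * Real.exp (N * (δ * R)) := by
          rw [Finset.prod_mul_distrib, Finset.prod_const, Finset.card_range, ← Real.exp_nat_mul]
      _ ≤ _ := by
          have : (N : ℝ) * δ ≤ η / 2 := by
            rw [hδ, mul_div_assoc', div_le_iff₀ (by positivity)]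
            nlinarith
          have hP : 0 ≤ ∏ k ∈ Finset.range N, (1 + c k / δ) :=
            Finset.prod_nonneg fun k _ => by have := hc k; positivity
          refine mul_le_mul_of_nonneg_left (Real.exp_le_exp.2 ?_) hP
          rw [← mul_assoc]
          exact mul_le_mul_of_nonneg_right this hR
  have h3 : ∏ j ∈ Finset.range n, (1 + R * c (j + N)) ≤ Real.exp (η / 2 * R) := by
    refine (prod_one_add_le_exp hR (fun k => hc (k + N)) ((summable_nat_add_iff N).2 hs) _).trans ?_
    rw [Real.exp_le_exp, mul_comm]
    exact mul_le_mul_of_nonneg_right hN.le hR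
  refine h1.trans ?_
  rw [add_comm n N, Finset.prod_range_add]
  simp only [add_comm N]
  calc _ ≤ ((∏ k ∈ Finset.range N, (1 + c k / δ)) * Real.exp (η / 2 * R)) *
        Real.exp (η / 2 * R) := by
        refine mul_le_mul h2 h3 (Finset.prod_nonneg fun k _ => zero_le_one.trans (hone _)) ?_
        exact (Finset.prod_nonneg fun k _ => zero_le_one.trans (hone k)).trans h2
    _ = _ := by rw [mul_assoc, ← Real.exp_add, ← add_mul, add_halves]

section Zeros

variable {s : ℕ → ℝ}

theorem differentiable_nevA (h : IsIndeterminate s) : Differentiable ℂ (nevA s : ℂ → ℂ) := by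
  rw [show (nevA s : ℂ → ℂ) = fun z => z * kerQ s z 0 from funext (nevA_eq s)]
  refine differentiable_id.mul fun z => ?_
  have : DifferentiableOn ℂ (fun z : ℂ => kerQ s z 0) (Metric.ball 0 (‖z‖ + 1)) := by
    refine Complex.differentiableOn_tsum_of_summable_norm
      ((summable_size₀ h).mul_right (Real.exp ((‖z‖ + 1) * ∑' k, size₀ s k ^ 2) ^ 2))
      (fun k => Differentiable.differentiableOn ?_) Metric.isOpen_ball fun k w hw => ?_
    · exact (Polynomial.differentiable_aeval (Q s k)).mul_const _
    · refine norm_mul_le_of_hasGrowth (hasGrowth_Q h) (hasGrowth_Q h) h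
        (mem_ball_zero_iff.1 hw).le ?_ k
      rw [norm_zero]; positivity
  exact this.differentiableAt (Metric.isOpen_ball.mem_nhds (by simp))

theorem isMinimalType_nevA (h : IsIndeterminate s) : IsMinimalType (nevA s) := by
  intro ε hε
  -- Half of `ε` pays for the product bound, the other half for the factor `z` in `A(z) = z K(z,
  -- 0)`.
  obtain ⟨K, hK0, hK⟩ := exists_prod_le_exp (fun k => sq_nonneg (size₀ s k)) (summable_size₀ h)
    (half_pos hε)
  refine ⟨2 / ε * ((∑' k, size₀ s k ^ 2) * K), fun z => ?_⟩
  have hterm : ∀ k, ‖aeval z (Q s k) * aeval 0 (Q s k)‖ ≤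
      size₀ s k ^ 2 * (K * Real.exp (ε / 2 * ‖z‖)) := by
    intro k
    have h1 := (hasGrowth_Q h z k).trans
      (mul_le_mul_of_nonneg_left (hK ‖z‖ (norm_nonneg z) k) (size₀_nonneg s k))
    have h2 : ‖aeval (0 : ℂ) (Q s k)‖ ≤ size₀ s k := by
      rw [← fundSize_zero (𝕜 := ℂ)]
      exact le_add_of_nonneg_left (norm_nonneg _)
    rw [norm_mul]
    calc _ ≤ (size₀ s k * (K * Real.exp (ε / 2 * ‖z‖))) * size₀ s k :=
          mul_le_mul h1 h2 (norm_nonneg _)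
            (mul_nonneg (size₀_nonneg s k) (mul_nonneg hK0 (Real.exp_nonneg _)))
      _ = _ := by ring
  have hker : ‖kerQ s z 0‖ ≤ (∑' k, size₀ s k ^ 2) * (K * Real.exp (ε / 2 * ‖z‖)) := by
    rw [← tsum_mul_right]
    exact tsum_of_norm_bounded ((summable_size₀ h).mul_right _).hasSum hterm
  have hz : ‖z‖ ≤ 2 / ε * Real.exp (ε / 2 * ‖z‖) := by
    have := Real.add_one_le_exp (ε / 2 * ‖z‖)
    calc ‖z‖ = 2 / ε * (ε / 2 * ‖z‖) := by field_simp
      _ ≤ _ := by gcongr; linarith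
  rw [nevA_eq, norm_mul]
  have hS0 : 0 ≤ ∑' k, size₀ s k ^ 2 := tsum_nonneg fun k => sq_nonneg _
  calc ‖z‖ * ‖kerQ s z 0‖ ≤ (2 / ε * Real.exp (ε / 2 * ‖z‖)) *
        ((∑' k, size₀ s k ^ 2) * (K * Real.exp (ε / 2 * ‖z‖))) := by gcongr
    _ = 2 / ε * ((∑' k, size₀ s k ^ 2) * K) *
        (Real.exp (ε / 2 * ‖z‖) * Real.exp (ε / 2 * ‖z‖)) := by ring
    _ = _ := by rw [← Real.exp_add]; ring_nf

theorem nevA_eq_zero_iff (h : IsIndeterminate s) (z : ℂ) :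
    nevA s z = 0 ↔ ∃ x : ℝ, nevA s x = 0 ∧ z = (x : ℂ) := by
  constructor
  · intro hz
    have e : z = (z.re : ℂ) := Complex.ext rfl (by simp [im_eq_zero_of_nevA_eq_zero h hz])
    refine ⟨z.re, ?_, e⟩
    rw [e, nevA_ofReal] at hz
    exact_mod_cast hz
  · rintro ⟨x, hx, rfl⟩
    rw [nevA_ofReal, hx, Complex.ofReal_zero]

theorem kerQ_ofReal (s : ℕ → ℝ) (x : ℝ) : kerQ s (x : ℂ) x = ((kerQ s x x : ℝ) : ℂ) := by
  rw [kerQ, kerQ, Complex.ofReal_tsum]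
  refine tsum_congr fun k => ?_
  have : aeval (x : ℂ) (Q s k) = (((Q s k).eval x : ℝ) : ℂ) := aeval_ofReal (𝕜 := ℂ) _ x
  rw [this, coe_aeval_eq_eval, Complex.ofReal_mul]

/-- At a zero `x`, the slope of `A` times `C(x)` is `K(y, x)`, which tends to `K(x, x) > 0`. -/
theorem deriv_nevA_ne_zero (h : IsIndeterminate s) {z : ℂ} (hz : nevA s z = 0) :
    deriv (nevA s) z ≠ 0 := by
  obtain ⟨x, hx, rfl⟩ := (nevA_eq_zero_iff h z).1 hz
  intro h0
  have hd := ((differentiable_nevA h) (x : ℂ)).hasDerivAt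
  rw [h0, hasDerivAt_iff_tendsto_slope] at hd
  have h1 := hd.mul_const (nevC s (x : ℂ))
  have h2 : Tendsto (fun y : ℂ => kerQ s y x) (𝓝[≠] (x : ℂ)) (𝓝 (kerQ s (x : ℂ) x)) :=
    (((continuous_kerQ h).comp (continuous_id.prodMk continuous_const)).tendsto
      (x : ℂ)).mono_left nhdsWithin_le_nhds
  have h3 : kerQ s (x : ℂ) x = 0 * nevC s (x : ℂ) := by
    refine tendsto_nhds_unique h2 (h1.congr' ?_)
    filter_upwards [self_mem_nhdsWithin] with y hy
    have hy' : y - x ≠ 0 := sub_ne_zero.2 hy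
    have := nevA_mul_nevC_sub h y x
    rw [hz, mul_zero, sub_zero] at this
    rw [slope_def_field, hz, sub_zero, div_mul_eq_mul_div, this]
    field_simp
  rw [kerQ_ofReal, zero_mul, Complex.ofReal_eq_zero] at h3
  exact (kerQ_self_pos h x).ne' h3

theorem infinite_zeros (h : IsIndeterminate s) (hS : IsStieltjes s) :
    {x : ℝ | nevA s x = 0}.Infinite := by
  intro hfin
  obtain ⟨K, N, hK0, hK⟩ := exists_polynomial_bound
    (hfin.toFinset.image ((↑) : ℝ → ℂ)) (differentiable_nevA h) (isMinimalType_nevA h)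
    (fun z hz => by
      obtain ⟨x, hx, rfl⟩ := (nevA_eq_zero_iff h z).1 hz
      simpa using hx)
    (fun z hz => deriv_nevA_ne_zero h hz)
  -- `Q_{N+2}` has degree `N + 1`, just enough to outgrow `x ^ N`.
  have hlim := tendsto_div_tsum_weight h hS (hasGrowth_Q h) (Nat.succ_pos (N + 1))
    (fun x hx => eval_Q_ne_zero h hS (Nat.succ_pos (N + 1)) hx) (p := X ^ N) (by
      rw [degree_X_pow, degree_Q_succ h (N + 1)]
      exact_mod_cast N.lt_succ_self)
  -- For `x ≤ -1` the polynomial bound gives `∑ T_k ≤ K 2^N |x|^N`; the extra `1` makes the lower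
  -- bound contradict it.
  have hpos : 0 < (K * 2 ^ N + 1)⁻¹ := by positivity
  obtain ⟨x, hx1, hx2⟩ := ((hlim.eventually_lt_const hpos).and
    (eventually_le_atBot (-1 : ℝ))).exists
  have hx0 : x ≤ 0 := by linarith
  have hS0 : 0 < ∑' j, weight s (Q s) j x :=
    (weight_pos h hS one_pos (eval_Q_ne_zero h hS one_pos hx0)).trans_le
      (weight_le_tsum h (hasGrowth_Q h) 1 x)
  have hb := hK (x : ℂ)
  rw [nevA_ofReal, Complex.norm_real, Complex.norm_real, Real.norm_eq_abs, Real.norm_eq_abs,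
    nevA_real_eq h hS hx0, abs_mul, abs_of_pos hS0] at hb
  rw [eval_pow, eval_X, div_lt_iff₀ hS0, abs_pow] at hx1
  have habs : 1 ≤ |x| := by rw [abs_of_nonpos hx0]; linarith
  have h1 : (1 + |x|) ^ N ≤ 2 ^ N * |x| ^ N := by
    rw [← mul_pow]
    exact pow_le_pow_left₀ (by positivity) (by linarith) N
  generalize (∑' j, weight s (Q s) j x) = S at *
  have h2 : S ≤ |x| * S := le_mul_of_one_le_left hS0.le habs
  have h3 : |x| * S ≤ K * (2 ^ N * |x| ^ N) := hb.trans (mul_le_mul_of_nonneg_left h1 hK0)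
  have h4 : (K * 2 ^ N + 1) * |x| ^ N < S := by
    rwa [inv_mul_eq_div, lt_div_iff₀ (by positivity), mul_comm] at hx1
  have h5 : 0 ≤ |x| ^ N := by positivity
  linarith

/-- No zero is negative, so infinitely many would accumulate in `[0, M]` at a zero, but zeros are
isolated. -/
theorem finite_zeros_Iic (h : IsIndeterminate s) (hS : IsStieltjes s) (M : ℝ) :
    ({x : ℝ | nevA s x = 0} ∩ Set.Iic M).Finite := by
  by_contra hinf
  have hsub : {x : ℝ | nevA s x = 0} ∩ Set.Iic M ⊆ Set.Icc 0 M := by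
    rintro x ⟨hx, hxM⟩
    refine ⟨?_, hxM⟩
    by_contra! hneg
    exact (nevA_neg h hS hneg).ne hx
  obtain ⟨a, -, ha⟩ := Set.Infinite.exists_accPt_of_subset_isCompact hinf isCompact_Icc hsub
  have hclosed : IsClosed {x : ℝ | nevA s x = 0} := isClosed_eq (continuous_nevA h) continuous_const
  have hacc : AccPt a (𝓟 {x : ℝ | nevA s x = 0}) := ha.mono (principal_mono.2 Set.inter_subset_left)
  have ha0 : nevA s a = 0 := hclosed.closure_subset (mem_closure_iff_clusterPt.2 hacc.clusterPt)
  rw [accPt_iff_frequently_nhdsNE] at hacc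
  exact hacc (eventually_nevA_ne_zero h ha0)

end Zeros

/-- An infinite set of reals with finite intersections with the half-lines
`(-∞, M]` is the range of a strictly increasing sequence. -/
theorem exists_strictMono_range {Z : Set ℝ} (hinf : Z.Infinite)
    (hfin : ∀ M, (Z ∩ Set.Iic M).Finite) : ∃ a : ℕ → ℝ, StrictMono a ∧ Set.range a = Z := by
  have hmin : ∀ W : Set ℝ, W ⊆ Z → W.Nonempty → ∃ m, IsLeast W m := by
    rintro W hW ⟨w, hw⟩
    have hf : (W ∩ Set.Iic w).Finite := (hfin w).subset (Set.inter_subset_inter_left _ hW)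
    obtain ⟨m, hm, hle⟩ := Set.exists_min_image _ id hf ⟨w, hw, le_refl w⟩
    refine ⟨m, hm.1, fun y hy => ?_⟩
    rcases le_total y w with h | h
    · exact hle y ⟨hy, h⟩
    · exact hm.2.trans h
  have hne : ∀ x, (Z ∩ Set.Ioi x).Nonempty := by
    intro x
    by_contra hempty
    rw [Set.not_nonempty_iff_eq_empty] at hempty
    refine hinf ((hfin x).subset fun y hy => ⟨hy, ?_⟩)
    by_contra hyx
    have : y ∈ Z ∩ Set.Ioi x := ⟨hy, Set.mem_Ioi.2 (not_le.1 hyx)⟩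
    rw [hempty] at this
    exact this
  choose next hnext using fun x => hmin _ Set.inter_subset_left (hne x)
  obtain ⟨m, hm⟩ := hmin Z subset_rfl hinf.nonempty
  let a : ℕ → ℝ := fun n => next^[n] m
  have hsucc : ∀ n, a (n + 1) = next (a n) := fun n => Function.iterate_succ_apply' next n m
  have hmono : StrictMono a := strictMono_nat_of_lt_succ fun n => by
    rw [hsucc]; exact (hnext (a n)).1.2
  have hmem : ∀ n, a n ∈ Z := by
    intro n
    cases n with
    | zero => exact hm.1
    | succ n => rw [hsucc]; exact (hnext (a n)).1.1
  refine ⟨a, hmono, Set.Subset.antisymm (Set.range_subset_iff.2 hmem) fun z hz => ?_⟩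
  by_contra hzr
  have hlt : ∀ n, a n < z := by
    intro n
    induction n with
    | zero => exact lt_of_le_of_ne (hm.2 hz) fun e => hzr ⟨0, e⟩
    | succ n ih =>
      refine lt_of_le_of_ne ?_ fun e => hzr ⟨n + 1, e⟩
      rw [hsucc]
      exact (hnext (a n)).2 ⟨hz, ih⟩
  exact Set.infinite_range_of_injective hmono.injective
    ((hfin z).subset (Set.range_subset_iff.2 fun n => ⟨hmem n, (hlt n).le⟩))

end MomentProblem

/-- Here `a 0 < a 1 < …` enumerates the zeros `α₁ < α₂ < …` of the entire function `A`. The first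
two limits in the last part say that `α(s)` is well defined, by either of its usual formulas. -/
theorem mainTheorem4 (s : ℕ → ℝ) (hindet : MomentProblem.IsIndeterminate s)
    (hstieltjes : MomentProblem.IsStieltjes s) :
    (∃ a : ℕ → ℝ, StrictMono a ∧
      (∀ z : ℂ, MomentProblem.nevA s z = 0 ↔ ∃ k : ℕ, z = (a k : ℂ)) ∧
      StrictAntiOn (fun x : ℝ => MomentProblem.nevC s x / MomentProblem.nevA s x)
        (Set.Iio (a 0)) ∧
      (∀ k : ℕ, StrictAntiOn (fun x : ℝ => MomentProblem.nevC s x / MomentProblem.nevA s x)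
        (Set.Ioo (a k) (a (k + 1)))) ∧
      (∀ k : ℕ, Tendsto (fun x : ℝ => MomentProblem.nevC s x / MomentProblem.nevA s x)
        (𝓝[<] (a k)) atBot) ∧
      (∀ k : ℕ, Tendsto (fun x : ℝ => MomentProblem.nevC s x / MomentProblem.nevA s x)
        (𝓝[>] (a k)) atTop)) ∧
    (Tendsto (fun n : ℕ => (MomentProblem.P s n).eval 0 / (MomentProblem.Q s n).eval 0)
        atTop (𝓝 (MomentProblem.alpha s)) ∧
      Tendsto (fun x : ℝ => MomentProblem.nevD s x / MomentProblem.nevB s x)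
        atBot (𝓝 (MomentProblem.alpha s)) ∧
      Tendsto (fun x : ℝ => MomentProblem.nevC s x / MomentProblem.nevA s x)
        atBot (𝓝 (MomentProblem.alpha s))) := by
  constructor
  · obtain ⟨a, hmono, hrange⟩ := MomentProblem.exists_strictMono_range
      (MomentProblem.infinite_zeros hindet hstieltjes)
      (MomentProblem.finite_zeros_Iic hindet hstieltjes)
    have hzero : ∀ x : ℝ, MomentProblem.nevA s x = 0 ↔ ∃ k, a k = x := fun x => by
      change x ∈ {x : ℝ | MomentProblem.nevA s x = 0} ↔ x ∈ Set.range a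
      rw [hrange]
    refine ⟨a, hmono, fun z => ?_, ?_, fun k => ?_, fun k => ?_, fun k => ?_⟩
    · rw [MomentProblem.nevA_eq_zero_iff hindet]
      constructor
      · rintro ⟨x, hx, rfl⟩
        obtain ⟨k, rfl⟩ := (hzero x).1 hx
        exact ⟨k, rfl⟩
      · rintro ⟨k, rfl⟩
        exact ⟨a k, (hzero _).2 ⟨k, rfl⟩, rfl⟩
    · refine MomentProblem.strictAntiOn_nevC_div_nevA hindet (convex_Iio _) fun x hx h0 => ?_
      obtain ⟨j, rfl⟩ := (hzero x).1 h0
      exact absurd (hmono.monotone j.zero_le) (not_le.2 hx)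
    · refine MomentProblem.strictAntiOn_nevC_div_nevA hindet (convex_Ioo _ _) fun x hx h0 => ?_
      obtain ⟨j, rfl⟩ := (hzero x).1 h0
      have h1 := hmono.lt_iff_lt.1 hx.1
      have h2 := hmono.lt_iff_lt.1 hx.2
      omega
    · exact MomentProblem.tendsto_nevC_div_nevA_left hindet ((hzero _).2 ⟨k, rfl⟩)
    · exact MomentProblem.tendsto_nevC_div_nevA_right hindet ((hzero _).2 ⟨k, rfl⟩)
  · obtain ⟨c, hc⟩ := MomentProblem.exists_tendsto_ratio hindet hstieltjes
    have hDB := MomentProblem.tendsto_nevD_div_nevB hindet hstieltjes hc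
    have halpha : MomentProblem.alpha s = c := hDB.limUnder_eq
    rw [halpha]
    exact ⟨hc, hDB, MomentProblem.tendsto_nevC_div_nevA_atBot hindet hstieltjes hc⟩
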